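/- Work in the algebra $\mathbb{Q}\langle\langle x_1,x_2,\ldots\rangle\rangle$ of formal power series in noncommuting variables. For a set partition $\pi$ of $[n]=\{1,\ldots,n\}$ let $m_\pi=\sum x_{i_1}x_{i_2}\cdots x_{i_n}$, summed over all tuples $(i_1,\ldots,i_n)$ of positive integers with $i_j=i_k$ if and only if $j$ and $k$ are in the same block of $\pi$, and let $h_\pi=\sum_{\sigma}\lambda(\sigma\wedge\pi)!\,m_\sigma$, where $\sigma$ runs over the set partitions of $[n]$, $\sigma\wedge\pi$ is the greatest lower bound for refinement, and $\lambda(\tau)!$ is the product of the factorials of the block sizes of $\tau$. For $k\ge 1$ let $h_{[k]}=h_\pi$ for the set partition $\pi$ of $[k]$ with one block; let $h_{[0]}=1$, and for $k<0$ read $\frac{1}{k!}h_{[k]}$ as $0$. A permutation $\delta\in\mathfrak{S}_n$ acts linearly on the series of degree $n$ by $\delta\circ x_{i_1}\cdots x_{i_n}=x_{i_{\delta^{-1}(1)}}\cdots x_{i_{\delta^{-1}(n)}}$; thus $\delta\circ m_\pi=m_{\delta\pi}$ and $\delta\circ h_\pi=h_{\delta\pi}$. Let $\lambda/\mu$ be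 a skew diagram of size $n$, where $\mu\subseteq\lambda$ are integer partitions and $\mu_j=0$ for $j>\ell(\mu)$. The skew Schur functions in noncommuting variables are $$s_{[\lambda/\mu]}=\sum_{\varepsilon\in\mathfrak{S}_{\ell(\lambda)}}\mathrm{sgn}(\varepsilon)\prod_{i=1}^{\ell(\lambda)}\frac{1}{(\lambda_i-\mu_{\varepsilon(i)}-i+\varepsilon(i))!}\,h_{[\lambda_i-\mu_{\varepsilon(i)}-i+\varepsilon(i)]},\qquad s_{(\delta,\lambda/\mu)}=\delta\circ s_{[\lambda/\mu]}\quad(\delta\in\mathfrak{S}_n),$$ where the factors are multiplied in the order $i=1,2,\ldots,\ell(\lambda)$. The Rosas--Sagan skew Schur function is $$S_{\lambda/\mu}=\sum_{\delta\in\mathfrak{S}_n}\ \sum_{T}\ x_{c(T_{\delta(1)})}x_{c(T_{\delta(2)})}\cdots x_{c(T_{\delta(n)})},$$ where $T$ runs over the semistandard Young tableaux of shape $\lambda/\mu$ (with positive integer entries, rows weakly increasing from left to right, columns strictly increasing from top to bottom), $T_1,\ldots,T_n$ are its boxes, read along each row from left to right and from the top row to the bottom row, and $c(T_k)$ is the entry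 in box $T_k$. A Young tableau $t$ of shape $\lambda\vdash n$ is a bijective filling of the boxes of $\lambda$ with $1,\ldots,n$; $\delta_t\in\mathfrak{S}_n$ is the permutation whose one-line notation is obtained by reading the rows of $t$ from left to right, from the top row to the bottom row; and $s_t=\delta_t\circ s_{[\lambda]}$. Two Young tableaux of shape $\lambda$ are row equivalent if, for every $i$, their $i$th rows contain the same elements. The tabloid $[t]$ is the row equivalence class of $t$, and $s_{[t]}=\sum_{\tilde t\in[t]}s_{\tilde t}$. When $\mu=\emptyset$, write $\lambda$ for $\lambda/\emptyset$. **Theorem.** Let $\lambda/\mu$ be a skew diagram of size $n$. Then $$\sum_{\delta\in\mathfrak{S}_n}s_{(\delta,\lambda/\mu)}=S_{\lambda/\mu}.$$ In particular, when $\mu=\emptyset$, $$\sum_{\delta\in\mathfrak{S}_n}s_{(\delta,\lambda)}=\sum_{t}s_t=\sum_{[t]}s_{[t]}=S_\lambda,$$ where $t$ runs over all Young tableaux of shape $\lambda$, and $[t]$ over all tabloids of shape $\lambda$. -/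

import Mathlib

open Equiv Finset
open scoped Nat

/-! ### Formal power series in noncommuting variables -/

/-- The formal power series in the noncommuting variables `x₁, x₂, …` over `ℚ`. The word
`[i₁, …, iₙ]` stands for the monomial `x_{i₁} ⋯ x_{iₙ}`, and a series is the family of the
coefficients of all words. -/
def NCPowerSeries : Type := List ℕ+ → ℚ

namespace NCPowerSeries

noncomputable instance : AddCommGroup NCPowerSeries :=
  inferInstanceAs (AddCommGroup (List ℕ+ → ℚ))

noncomputable instance : Module ℚ NCPowerSeries :=
  inferInstanceAs (Module ℚ (List ℕ+ → ℚ))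

/-- The constant series `1`, whose only monomial is the empty word. -/
noncomputable instance : One NCPowerSeries := ⟨fun w => if w = [] then 1 else 0⟩

/-- The product extends the concatenation of words: the coefficient of `w` is the sum over all
the ways to cut `w` in two. -/
noncomputable instance : Mul NCPowerSeries :=
  ⟨fun f g w => ∑ k ∈ range (w.length + 1), f (w.take k) * g (w.drop k)⟩

@[ext] theorem ext {f g : NCPowerSeries} (h : ∀ w, f w = g w) : f = g := funext h

theorem add_apply (f g : NCPowerSeries) (w : List ℕ+) : (f + g) w = f w + g w := rfl

theorem zero_apply (w : List ℕ+) : (0 : NCPowerSeries) w = 0 := rfl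

theorem smul_apply (c : ℚ) (f : NCPowerSeries) (w : List ℕ+) : (c • f) w = c * f w := rfl

theorem one_apply (w : List ℕ+) : (1 : NCPowerSeries) w = if w = [] then 1 else 0 := rfl

theorem mul_apply (f g : NCPowerSeries) (w : List ℕ+) :
    (f * g) w = ∑ k ∈ range (w.length + 1), f (w.take k) * g (w.drop k) := rfl

theorem sum_apply {ι : Type*} (s : Finset ι) (f : ι → NCPowerSeries) (w : List ℕ+) :
    (∑ i ∈ s, f i) w = ∑ i ∈ s, f i w :=
  Finset.sum_apply w s f

theorem mul_nil (f g : NCPowerSeries) : (f * g) [] = f [] * g [] := by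
  simp [mul_apply]

/-- The series with the coefficient of `a :: w` in `f` as the coefficient of `w`. -/
def strip (a : ℕ+) (f : NCPowerSeries) : NCPowerSeries := fun w => f (a :: w)

theorem mul_cons (f g : NCPowerSeries) (a : ℕ+) (w : List ℕ+) :
    (f * g) (a :: w) =
      f [] * g (a :: w) + (strip a f * g) w := by
  rw [mul_apply, mul_apply, List.length_cons, sum_range_succ']
  simp [add_comm, strip]

theorem mul_assoc_apply (w : List ℕ+) :
    ∀ f g h : NCPowerSeries, (f * g * h) w = (f * (g * h)) w := by
  induction w with
  | nil => intro f g h; simp [mul_nil, mul_assoc]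
  | cons a w ih =>
    intro f g h
    have key : strip a (f * g) = f [] • strip a g + strip a f * g :=
      funext fun v => mul_cons f g a v
    rw [mul_cons, mul_cons f, mul_nil, key, ← ih, mul_cons g, mul_add, mul_apply, mul_apply (strip a g)]
    simp only [mul_apply _ h, add_apply, smul_apply, add_mul, sum_add_distrib, mul_sum, mul_assoc,
      add_assoc]

noncomputable instance : Ring NCPowerSeries :=
  { (inferInstance : AddCommGroup NCPowerSeries),
    (inferInstance : One NCPowerSeries), (inferInstance : Mul NCPowerSeries) with
    mul_assoc := fun f g h => ext fun w => mul_assoc_apply w f g h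
    one_mul := fun f => by
      ext w
      cases w with
      | nil => simp [mul_nil, one_apply]
      | cons a w =>
        have : strip a 1 = 0 := funext fun v => by simp [strip, one_apply, zero_apply]
        rw [mul_cons, this, mul_apply]
        simp [one_apply, zero_apply]
    mul_one := fun f => by
      ext w
      rw [mul_apply, sum_range_succ, sum_eq_zero]
      · simp [one_apply]
      · intro k hk
        have : w.drop k ≠ [] := by
          simp only [ne_eq, List.drop_eq_nil_iff]
          simpa using hk
        simp [one_apply, this]
    zero_mul := fun f => by ext w; simp [mul_apply, zero_apply]
    mul_zero := fun f => by ext w; simp [mul_apply, zero_apply]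
    left_distrib := fun f g h => by
      ext w; simp [mul_apply, add_apply, mul_add, sum_add_distrib]
    right_distrib := fun f g h => by
      ext w; simp [mul_apply, add_apply, add_mul, sum_add_distrib]
    zsmul := fun k f => k • f
    zsmul_zero' := fun f => zero_smul ℤ f
    zsmul_succ' := fun k f => SubNegMonoid.zsmul_succ' k f
    zsmul_neg' := fun k f => SubNegMonoid.zsmul_neg' k f
    nsmul := fun k f => k • f
    nsmul_zero := fun f => zero_smul ℕ f
    nsmul_succ := fun k f => AddMonoid.nsmul_succ k f }

end NCPowerSeries

/-! ### Symmetric functions in noncommuting variables -/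

/-- A set partition of `[n]`. -/
abbrev SetPartition (n : ℕ) : Type := Finpartition (univ : Finset (Fin n))

open Classical in
/-- The monomial symmetric function `m_π`, the sum of the monomials `x_{i₁} ⋯ x_{iₙ}` such that
`i_j = i_k` if and only if `j` and `k` are in the same block of `π`. -/
noncomputable def ncMonomial {n : ℕ} (π : SetPartition n) : NCPowerSeries := fun w =>
  if ∃ i : Fin n → ℕ+, w = List.ofFn i ∧
      ∀ j k, i j = i k ↔ ∃ B ∈ π.parts, j ∈ B ∧ k ∈ B then 1 else 0

/-- `λ(π)!`, the product of the factorials of the block sizes of `π`. -/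
def blockFactorial {n : ℕ} (π : SetPartition n) : ℕ := ∏ B ∈ π.parts, (#B)!

/-- The complete homogeneous symmetric function `h_π = ∑_σ λ(σ ∧ π)! m_σ`; here `⊓` is the
greatest lower bound for the refinement order. -/
noncomputable def ncComplete {n : ℕ} (π : SetPartition n) : NCPowerSeries :=
  ∑ σ : SetPartition n, (blockFactorial (σ ⊓ π) : ℚ) • ncMonomial σ

/-- The coefficients of `δ ∘ f`; see `permAct`. -/
def permSeries {n : ℕ} (δ : Perm (Fin n)) (f : NCPowerSeries) : NCPowerSeries := fun w =>
  if h : w.length = n then f (List.ofFn fun k => w.get ((δ k).cast h.symm)) else f w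

/-- The action of `δ ∈ 𝔖ₙ` on series that are homogeneous of degree `n`, by permuting places:
`δ ∘ x_{i_1} ⋯ x_{i_n} = x_{i_{δ⁻¹(1)}} ⋯ x_{i_{δ⁻¹(n)}}`, so that the coefficient of
`x_{i_1} ⋯ x_{i_n}` in `δ ∘ f` is that of `x_{i_{δ(1)}} ⋯ x_{i_{δ(n)}}` in `f`. (Monomials of a
degree other than `n`, on which `𝔖ₙ` is not meant to act, are left alone.)  The two lemmas
`permAct_ncMonomial` and `permAct_ncComplete` below show `δ ∘ m_π = m_{δπ}` and
`δ ∘ h_π = h_{δπ}`. -/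
noncomputable def permAct {n : ℕ} (δ : Perm (Fin n)) : NCPowerSeries →ₗ[ℚ] NCPowerSeries where
  toFun := permSeries δ
  map_add' f g := by
    ext w
    simp only [permSeries, NCPowerSeries.add_apply]
    split_ifs <;> rfl
  map_smul' c f := by
    ext w
    simp only [permSeries, NCPowerSeries.smul_apply]
    split_ifs <;> rfl

theorem permAct_ofFn {n : ℕ} (δ : Perm (Fin n)) (f : NCPowerSeries) (i : Fin n → ℕ+) :
    permAct δ f (List.ofFn i) = f (List.ofFn (i ∘ δ)) := by
  refine (dif_pos (List.length_ofFn (f := i))).trans ?_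
  congr 2
  funext k
  simp

theorem permAct_of_length_ne {n : ℕ} (δ : Perm (Fin n)) (f : NCPowerSeries) (w : List ℕ+)
    (h : w.length ≠ n) : permAct δ f w = f w :=
  dif_neg h

/-- The natural action of permutations on set partitions: `δπ` has the blocks `δ(B)`. -/
def permPartition {n : ℕ} (δ : Perm (Fin n)) (π : SetPartition n) : SetPartition n :=
  (π.map ({ toEquiv := δ.finsetCongr
            map_rel_iff' := by simp } : Finset (Fin n) ≃o Finset (Fin n))).copy (by
    ext x
    simp)

theorem permPartition_parts {n : ℕ} (δ : Perm (Fin n)) (π : SetPartition n) :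
    (permPartition δ π).parts = π.parts.map δ.finsetCongr.toEmbedding := rfl

theorem permPartition_inv {n : ℕ} (δ : Perm (Fin n)) (π : SetPartition n) :
    permPartition δ (permPartition δ⁻¹ π) = π := by
  apply Finpartition.ext
  ext B
  simp only [permPartition_parts, mem_map_equiv]
  constructor
  · intro h
    convert h using 1
    ext x
    simp [Finset.mem_map_equiv, Perm.inv_def]
  · intro h
    convert h using 1
    ext x
    simp [Finset.mem_map_equiv, Perm.inv_def]

theorem blockFactorial_permPartition_inf {n : ℕ} (δ : Perm (Fin n)) (σ π : SetPartition n) :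
    blockFactorial (permPartition δ σ ⊓ permPartition δ π) = blockFactorial (σ ⊓ π) := by
  have h : (permPartition δ σ ⊓ permPartition δ π).parts =
      (σ ⊓ π).parts.map δ.finsetCongr.toEmbedding := by
    ext B
    simp only [Finpartition.parts_inf, permPartition_parts, mem_map, mem_erase, mem_image,
      mem_product, Prod.exists]
    constructor
    · rintro ⟨hB, _, _, ⟨⟨C, hC, rfl⟩, ⟨D, hD, rfl⟩⟩, rfl⟩
      refine ⟨C ⊓ D, ⟨?_, C, D, ⟨hC, hD⟩, rfl⟩, ?_⟩
      · intro h0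
        apply hB
        simp only [inf_eq_inter, bot_eq_empty] at h0
        have := Finset.map_inter (f := δ.toEmbedding) C D
        simp [← this, h0]
      · simp [Finset.map_inter]
    · rintro ⟨_, ⟨hE, C, D, ⟨hC, hD⟩, rfl⟩, rfl⟩
      refine ⟨?_, _, _, ⟨⟨C, hC, rfl⟩, ⟨D, hD, rfl⟩⟩, ?_⟩
      · intro h0
        apply hE
        simpa using h0
      · simp [Finset.map_inter]
  unfold blockFactorial
  rw [h, prod_map]
  simp

theorem permAct_ncMonomial {n : ℕ} (δ : Perm (Fin n)) (π : SetPartition n) :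
    permAct δ (ncMonomial π) = ncMonomial (permPartition δ π) := by
  ext w
  by_cases hw : w.length = n
  · obtain ⟨i, rfl⟩ : ∃ i : Fin n → ℕ+, w = List.ofFn i := by
      subst hw
      exact ⟨w.get, (List.ofFn_get w).symm⟩
    rw [permAct_ofFn]
    unfold ncMonomial
    congr 1
    simp only [List.ofFn_inj, permPartition_parts, mem_map, exists_exists_and_eq_and,
      exists_eq_left', eq_iff_iff]
    constructor
    · intro h j k
      have := h (δ.symm j) (δ.symm k)
      simpa [Finset.mem_map_equiv] using this
    · intro h j k
      have := h (δ j) (δ k)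
      simpa [Finset.mem_map_equiv] using this
  · have h0 : ∀ σ : SetPartition n, ncMonomial σ w = 0 := by
      intro σ
      unfold ncMonomial
      rw [if_neg]
      rintro ⟨i, rfl, -⟩
      simp at hw
    rw [permAct_of_length_ne _ _ _ hw, h0, h0]

theorem permAct_ncComplete {n : ℕ} (δ : Perm (Fin n)) (π : SetPartition n) :
    permAct δ (ncComplete π) = ncComplete (permPartition δ π) := by
  unfold ncComplete
  rw [map_sum]
  refine Fintype.sum_bijective (permPartition δ)
    (Function.bijective_iff_has_inverse.2 ⟨permPartition δ⁻¹, ?_, permPartition_inv δ⟩) _ _ ?_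
  · intro σ
    simpa using permPartition_inv δ⁻¹ σ
  · intro σ
    rw [map_smul, permAct_ncMonomial, blockFactorial_permPartition_inf]

/-- The entry `h_{[k]} / k!`, where `[k]` is the set partition of `{1, …, k}` with at most one
block (none if `k = 0`); it is `0` for negative `k`. -/
noncomputable def scaledComplete : ℤ → NCPowerSeries
  | Int.ofNat k => (1 / (k ! : ℚ)) • ncComplete (⊤ : SetPartition k)
  | Int.negSucc _ => 0

/-- Leibniz' formula for the determinant of a matrix with noncommuting entries: the products are
taken from the top row to the bottom row. -/
def ncDet {R : Type*} [Ring R] {l : ℕ} (A : Matrix (Fin l) (Fin l) R) : R :=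
  ∑ ε : Perm (Fin l), (Perm.sign ε : ℤ) • (List.ofFn fun i => A i (ε i)).prod

/-! ### Skew diagrams and tableaux -/

/-- A skew diagram `λ/μ`, given by the (Young diagrams of the) partitions `μ ⊆ λ`. -/
structure SkewDiagram where
  /-- the partition `λ` -/
  outer : YoungDiagram
  /-- the partition `μ` -/
  inner : YoungDiagram
  inner_le : inner ≤ outer

namespace SkewDiagram

/-- The boxes (row, column) of `λ/μ`, indexed from `0`. -/
def boxes (D : SkewDiagram) : Finset (ℕ × ℕ) := D.outer.cells \ D.inner.cells

/-- The type of the boxes of `λ/μ`. -/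
abbrev Box (D : SkewDiagram) : Type := {b : ℕ × ℕ // b ∈ D.boxes}

/-- The size of `λ/μ`. -/
def size (D : SkewDiagram) : ℕ := #D.boxes

/-- The diagram `λ = λ/∅`. -/
def straight (lam : YoungDiagram) : SkewDiagram := ⟨lam, ⊥, bot_le⟩

/-- The boxes in reading order: each row from left to right, the rows from top to bottom (that
is, in the lexicographic order of the pairs (row, column)). -/
def readingOrder (D : SkewDiagram) : Fin D.size ≃ D.Box :=
  (Finset.orderIsoOfFin (D.boxes.map (toLex (α := ℕ × ℕ)).toEmbedding)
    (Finset.card_map _)).toEquiv.trans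
      ((Equiv.subtypeEquiv toLex fun b => by simp).symm)

end SkewDiagram

/-- The source skew Schur function in noncommuting variables `s_{[λ/μ]}`, the determinant of the
matrix of the `h_{[λ_i - μ_j - i + j]} / (λ_i - μ_j - i + j)!` for `1 ≤ i, j ≤ ℓ(λ)`. -/
noncomputable def sourceSchur (D : SkewDiagram) : NCPowerSeries :=
  ncDet (Matrix.of fun i j : Fin (D.outer.colLen 0) =>
    scaledComplete ((D.outer.rowLen i : ℤ) - (D.inner.rowLen j : ℤ) - (i : ℤ) + (j : ℤ)))

/-- The skew Schur function in noncommuting variables `s_{(δ, λ/μ)} = δ ∘ s_{[λ/μ]}`. -/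
noncomputable def ncSchur (D : SkewDiagram) (δ : Perm (Fin D.size)) : NCPowerSeries :=
  permAct δ (sourceSchur D)

/-- A Young tableau of shape `λ/μ` of size `n`: a bijective filling of the boxes with the `n`
elements of `Fin n`, which stand for `1, …, n`. -/
abbrev YoungTableau (D : SkewDiagram) : Type := D.Box ≃ Fin D.size

namespace YoungTableau

/-- The permutation `δ_t` of a Young tableau; its one-line notation is the list of the entries
of `t` in reading order. -/
def perm {D : SkewDiagram} (t : YoungTableau D) : Perm (Fin D.size) := D.readingOrder.trans t

/-- `s_t = δ_t ∘ s_{[sh(t)]}`. -/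
noncomputable def schur {D : SkewDiagram} (t : YoungTableau D) : NCPowerSeries :=
  permAct (perm t) (sourceSchur D)

/-- Two Young tableaux of the same shape are row equivalent if for all `i` their rows `i` contain
the same elements. -/
def rowEquivalence (D : SkewDiagram) : Setoid (YoungTableau D) where
  r t₁ t₂ := ∀ i : ℕ, t₁ '' {b | b.1.1 = i} = t₂ '' {b | b.1.1 = i}
  iseqv := ⟨fun _ _ => rfl, fun h i => (h i).symm, fun h₁ h₂ i => (h₁ i).trans (h₂ i)⟩

open Classical in
/-- `s_{[t]}`, the sum of the `s_{t'}` over all Young tableaux `t'` row equivalent to `t`. -/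
noncomputable def rowSchur {D : SkewDiagram} (t : YoungTableau D) : NCPowerSeries :=
  ∑ t' : YoungTableau D with (rowEquivalence D).r t t', schur t'

end YoungTableau

/-- A tabloid `[t]` of shape `λ/μ`, a class of row equivalent Young tableaux. -/
abbrev Tabloid (D : SkewDiagram) : Type := Quotient (YoungTableau.rowEquivalence D)

open Classical in
noncomputable instance (D : SkewDiagram) : Fintype (Tabloid D) := Quotient.fintype _

/-- The function `s_{[t]}` of a tabloid `[t]`. -/
noncomputable def Tabloid.schur {D : SkewDiagram} (c : Tabloid D) : NCPowerSeries :=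
  Quotient.lift YoungTableau.rowSchur (fun t₁ t₂ h => by
    unfold YoungTableau.rowSchur
    congr 1
    ext t'
    simp only [mem_filter, mem_univ, true_and]
    exact ⟨fun h' => (YoungTableau.rowEquivalence D).trans
        ((YoungTableau.rowEquivalence D).symm h) h',
      fun h' => (YoungTableau.rowEquivalence D).trans h h'⟩) c

/-- A semistandard Young tableau of shape `λ/μ`: the boxes are filled with positive integers such
that the rows weakly increase from left to right, and the columns strictly increase from top to
bottom. -/
structure SkewSSYT (D : SkewDiagram) where
  entry : D.Box → ℕ+
  row_weak : ∀ b c : D.Box, b.1.1 = c.1.1 → b.1.2 < c.1.2 → entry b ≤ entry c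
  col_strict : ∀ b c : D.Box, b.1.2 = c.1.2 → b.1.1 < c.1.1 → entry b < entry c

/-- The word of the monomial `x_{c(T_{δ(1)})} ⋯ x_{c(T_{δ(n)})}`, where `T_1, …, T_n` are the
boxes of `T` in reading order and `c(T_k)` is the entry in the box `T_k`. -/
def SkewSSYT.word {D : SkewDiagram} (T : SkewSSYT D) (δ : Perm (Fin D.size)) : List ℕ+ :=
  List.ofFn fun k => T.entry (D.readingOrder (δ k))

/-- Each monomial occurs only finitely often in the Rosas-Sagan skew Schur function. -/
instance (D : SkewDiagram) (w : List ℕ+) :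
    Finite {p : Perm (Fin D.size) × SkewSSYT D // p.2.word p.1 = w} := by
  refine Finite.of_injective (fun p => p.1.1) ?_
  rintro ⟨⟨δ, T⟩, h⟩ ⟨⟨δ', T'⟩, h'⟩ (rfl : δ = δ')
  simp only at h h'
  have e := h.trans h'.symm
  simp only [SkewSSYT.word, List.ofFn_inj] at e
  have : T = T' := by
    cases T with | mk f _ _ =>
    cases T' with | mk g _ _ =>
    have : f = g := by
      ext b
      have := congrFun e (δ.symm (D.readingOrder.symm b))
      simpa using congrArg PNat.val this
    subst this
    rfl
  subst this
  rfl

/-- The Rosas-Sagan skew Schur function `S_{λ/μ}`, the formal sum of the monomials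
`x_{c(T_{δ(1)})} ⋯ x_{c(T_{δ(n)})}` over all `δ ∈ 𝔖ₙ` and all semistandard Young tableaux `T` of
shape `λ/μ`: the coefficient of a word is the number of the pairs `(δ, T)` that yield it. -/
noncomputable def rosasSagan (D : SkewDiagram) : NCPowerSeries := fun w =>
  (Nat.card {p : Perm (Fin D.size) × SkewSSYT D // p.2.word p.1 = w} : ℚ)

/-! The coefficient of a word in a symmetrized series `∑ δ, δ ∘ f` is the number of the permutations
that fix the word, times the sum of the coefficients of `f` at all rearrangements of the word
(`sum_perm_ofFn_comp`). That sum is a coefficient of the image of `f` under the ring homomorphism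
`commImage` that lets the variables commute. This homomorphism maps `h_{[k]} / k!` to the
complete homogeneous polynomial of degree `k` (`commImage_scaledComplete`), hence the
noncommutative determinant `s_{[λ/μ]}` to the Jacobi-Trudi determinant of `λ/μ`. On the other
side, each semistandard tableau contributes to the coefficient of a word of its content in
`S_{λ/μ}` the same number of permutations (`SkewSSYT.rosasSagan_ofFn`). So the identity is the
Jacobi-Trudi formula: the coefficients of that determinant count the semistandard tableaux of
shape `λ/μ` by content (`SkewSSYT.coeff_det_jacobiTrudi`).

The Jacobi-Trudi formula is proved by splitting off one variable `x` at a time. If each row of the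
determinant is reduced by `x ^ (λ_i - λ_{i+1} + 1)` times the next row, then row `i` becomes a sum
over `ν_i` with `λ_{i+1} ≤ ν_i ≤ λ_i`, in fewer variables, and multilinearity gives a sum over the
`ν` such that `λ/ν` is a horizontal strip (`det_jacobiTrudi_succ`). Iterating this, one obtains a
sum over chains of partitions from `μ` to `λ` (`det_jacobiTrudi`), and these chains are the
semistandard tableaux (`SkewSSYT.contentEquiv`).

The sums over tableaux and tabloids only regroup the sum over all permutations.
-/

/-! ### The Jacobi-Trudi determinant in commuting variables -/

section JacobiTrudi

variable {R : Type*} [CommRing R]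

/-- The complete homogeneous symmetric polynomial of degree `k` in the `m` variables
`x 0, …, x (m - 1)`, defined by splitting off the power of the last variable. -/
def completeHomog (x : ℕ → R) : ℕ → ℕ → R
  | 0, k => if k = 0 then 1 else 0
  | m + 1, k => ∑ j ∈ range (k + 1), x m ^ (k - j) * completeHomog x m j

/-- `completeHomog` with an integer degree; it vanishes in negative degrees. -/
def completeHomogInt (x : ℕ → R) (m : ℕ) : ℤ → R
  | Int.ofNat k => completeHomog x m k
  | Int.negSucc _ => 0

theorem completeHomogInt_of_neg (x : ℕ → R) (m : ℕ) {k : ℤ} (hk : k < 0) :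
    completeHomogInt x m k = 0 := by
  obtain ⟨j, rfl⟩ := Int.eq_negSucc_of_lt_zero hk
  rfl

theorem completeHomogInt_zero (x : ℕ → R) (k : ℤ) :
    completeHomogInt x 0 k = if k = 0 then 1 else 0 := by
  cases k with
  | ofNat k => simp [completeHomogInt, completeHomog]
  | negSucc k => simp [completeHomogInt]

theorem completeHomog_succ_succ (x : ℕ → R) (m k : ℕ) :
    completeHomog x (m + 1) (k + 1) =
      x m * completeHomog x (m + 1) k + completeHomog x m (k + 1) := by
  rw [completeHomog, sum_range_succ, completeHomog, mul_sum]
  simp only [Nat.sub_self, pow_zero, one_mul, add_left_inj]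
  refine sum_congr rfl fun j hj => ?_
  rw [Nat.succ_sub (by simpa [Nat.lt_succ_iff] using hj), pow_succ']
  ring

theorem completeHomogInt_succ (x : ℕ → R) (m : ℕ) (k : ℤ) :
    completeHomogInt x (m + 1) k =
      x m * completeHomogInt x (m + 1) (k - 1) + completeHomogInt x m k := by
  rcases lt_trichotomy k 0 with hk | rfl | hk
  · rw [completeHomogInt_of_neg _ _ hk, completeHomogInt_of_neg _ _ hk,
      completeHomogInt_of_neg _ _ (by omega)]
    simp
  · rw [completeHomogInt_of_neg _ _ (by omega : (0 : ℤ) - 1 < 0)]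
    change completeHomog x (m + 1) 0 = x m * 0 + completeHomog x m 0
    simp [completeHomog]
  · obtain ⟨j, rfl⟩ : ∃ j : ℕ, k = ((j + 1 : ℕ) : ℤ) := ⟨(k - 1).toNat, by omega⟩
    rw [show (((j + 1 : ℕ) : ℤ) - 1) = (j : ℤ) by push_cast; ring]
    exact completeHomog_succ_succ x m j

/-- Subtracting from a complete homogeneous polynomial a multiple of one of smaller degree leaves
the terms in which the exponent of the last variable is small. -/
theorem completeHomogInt_succ_eq_sum (x : ℕ → R) (m : ℕ) (c : ℤ) {a b : ℕ} (hab : a ≤ b + 1) :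
    completeHomogInt x (m + 1) (b + c) =
      ∑ p ∈ Icc a b, x m ^ (b - p) * completeHomogInt x m (p + c) +
        x m ^ (b + 1 - a) * completeHomogInt x (m + 1) (a - 1 + c) := by
  obtain ⟨d, hd⟩ : ∃ d, b + 1 = a + d := ⟨b + 1 - a, by omega⟩
  induction d generalizing b with
  | zero =>
    rw [Icc_eq_empty (by omega), show b + 1 - a = 0 by omega]
    simp only [sum_empty, pow_zero, one_mul, zero_add]
    congr 1
    omega
  | succ d ih =>
    rw [completeHomogInt_succ]
    rcases Nat.eq_zero_or_pos b with rfl | hb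
    · obtain rfl : a = 0 := by omega
      simp
      rw [add_comm]
      congr 3
      ring
    · obtain ⟨b, rfl⟩ : ∃ e, b = e + 1 := ⟨b - 1, by omega⟩
      have h := ih (b := b) (by omega) (by omega)
      rw [show (((b + 1 : ℕ) : ℤ) + c - 1) = b + c by push_cast; ring, h,
        ← insert_Icc_right_eq_Icc_add_one (by omega : a ≤ b + 1), sum_insert (by simp), mul_add, mul_sum,
        show b + 1 + 1 - a = (b + 1 - a) + 1 by omega, pow_succ']
      simp only [Nat.sub_self, pow_zero, one_mul]
      have : ∑ p ∈ Icc a b, x m ^ (b + 1 - p) * completeHomogInt x m (p + c) =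
          ∑ p ∈ Icc a b, x m * (x m ^ (b - p) * completeHomogInt x m (p + c)) := by
        refine sum_congr rfl fun p hp => ?_
        rw [Nat.succ_sub (mem_Icc.1 hp).2, pow_succ']
        ring
      rw [this]
      ring

/-- The `i`-th part of the partition with the parts `lam 0, …, lam (l - 1)`, which is `0` for
`i ≥ l`. -/
def extendZero {l : ℕ} (lam : Fin l → ℕ) (i : ℕ) : ℕ := if h : i < l then lam ⟨i, h⟩ else 0

/-- The `nu` such that `lam / nu` is a horizontal strip, that is,
`lam (i + 1) ≤ nu i ≤ lam i` for all `i`. -/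
def stripSet {l : ℕ} (lam : Fin l → ℕ) : Finset (Fin l → ℕ) :=
  Fintype.piFinset fun i => Icc (extendZero lam (i + 1)) (lam i)

theorem extendZero_val {l : ℕ} (lam : Fin l → ℕ) (i : Fin l) : extendZero lam i = lam i := by
  simp [extendZero]

theorem mem_stripSet {l : ℕ} {lam nu : Fin l → ℕ} :
    nu ∈ stripSet lam ↔ ∀ i : Fin l, extendZero lam (i + 1) ≤ nu i ∧ nu i ≤ lam i := by
  simp [stripSet]

theorem extendZero_succ_le {l : ℕ} {lam : Fin l → ℕ} (h : Antitone lam) (i : Fin l) :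
    extendZero lam (i + 1) ≤ lam i := by
  unfold extendZero
  split_ifs with hi
  · exact h (Fin.mk_le_mk.2 (Nat.le_succ _))
  · exact Nat.zero_le _

theorem antitone_of_mem_stripSet {l : ℕ} {lam nu : Fin l → ℕ} (h : nu ∈ stripSet lam) :
    Antitone nu := by
  cases l with
  | zero => exact fun i => i.elim0
  | succ l =>
    refine Fin.antitone_iff_succ_le.2 fun i => ?_
    have h1 := (mem_stripSet.1 h i.castSucc).1
    have h2 := (mem_stripSet.1 h i.succ).2
    have h3 : extendZero lam (i.castSucc + 1) = lam i.succ := by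
      rw [← extendZero_val lam i.succ]; rfl
    omega

/-- The matrix of the Jacobi-Trudi formula. -/
def jacobiTrudi (x : ℕ → R) (m : ℕ) {l : ℕ} (lam mu : Fin l → ℕ) : Matrix (Fin l) (Fin l) R :=
  Matrix.of fun i j => completeHomogInt x m ((lam i : ℤ) - mu j - i + j)

/-- A unitriangular row operation does not change the determinant: a multiple of each row is
added to the row before it. -/
theorem det_eq_of_forall_row_eq_smul_add_next {l : ℕ} {A B : Matrix (Fin l) (Fin l) R}
    (c : Fin l → R)
    (h : ∀ i j, A i j = B i j + c i * if h : (i : ℕ) + 1 < l then A ⟨i + 1, h⟩ j else 0) :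
    A.det = B.det := by
  cases l with
  | zero => simp
  | succ l =>
    rw [← Matrix.det_submatrix_equiv_self Fin.revPerm A,
      ← Matrix.det_submatrix_equiv_self Fin.revPerm B]
    refine Matrix.det_eq_of_forall_row_eq_smul_add_pred (fun i => c i.succ.rev) (fun j => ?_)
      fun i j => ?_
    · simp only [Matrix.submatrix_apply, Fin.revPerm_apply]
      rw [h]
      simp
    · simp only [Matrix.submatrix_apply, Fin.revPerm_apply]
      have hlt : (i.succ.rev : ℕ) + 1 < l + 1 := by
        have := i.2
        rw [Fin.val_rev, Fin.val_succ]
        omega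
      rw [h, dif_pos hlt]
      have hidx : ∀ h : (i.succ.rev : ℕ) + 1 < l + 1,
          (⟨i.succ.rev + 1, h⟩ : Fin (l + 1)) = i.castSucc.rev := fun h => by
        ext
        simp only [Fin.val_rev, Fin.val_succ, Fin.val_castSucc]
        omega
      rw [hidx]

/-- The recursion for the Jacobi-Trudi determinant that splits off the last variable. Subtracting
from each row the right multiple of the next one leaves in row `i` the sum over the `nu i` between
`lam (i + 1)` and `lam i`, and the determinant is multilinear in its rows. -/
theorem det_jacobiTrudi_succ (x : ℕ → R) (m : ℕ) {l : ℕ} {lam : Fin l → ℕ} (mu : Fin l → ℕ)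
    (hlam : Antitone lam) :
    (jacobiTrudi x (m + 1) lam mu).det =
      ∑ nu ∈ stripSet lam, x m ^ (∑ i, lam i - ∑ i, nu i) * (jacobiTrudi x m nu mu).det := by
  have step : (jacobiTrudi x (m + 1) lam mu).det = (Matrix.of fun i j : Fin l =>
      ∑ p ∈ Icc (extendZero lam (i + 1)) (lam i),
        x m ^ (lam i - p) * completeHomogInt x m ((p : ℤ) - mu j - i + j)).det := by
    refine det_eq_of_forall_row_eq_smul_add_next
      (fun i => x m ^ (lam i + 1 - extendZero lam (i + 1))) fun i j => ?_
    have hle := extendZero_succ_le hlam i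
    have key := completeHomogInt_succ_eq_sum x m (-(mu j : ℤ) - i + j) (Nat.le_succ_of_le hle)
    simp only [jacobiTrudi, Matrix.of_apply]
    have hshift : ∀ p : ℤ, p - mu j - i + j = p + (-(mu j : ℤ) - i + j) := fun p => by ring
    simp only [hshift]
    rw [key]
    congr 2
    split_ifs with hi
    · simp only [extendZero, hi, dite_true]
      congr 1
      push_cast
      ring
    · rw [completeHomogInt_of_neg]
      simp only [extendZero, hi, dite_false]
      have := j.2
      push_cast
      omega
  rw [step]
  have hrow : (Matrix.of fun i j : Fin l =>
      ∑ p ∈ Icc (extendZero lam (i + 1)) (lam i),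
        x m ^ (lam i - p) * completeHomogInt x m ((p : ℤ) - mu j - i + j)) =
      fun i : Fin l => ∑ p ∈ Icc (extendZero lam (i + 1)) (lam i),
        x m ^ (lam i - p) • fun j : Fin l => completeHomogInt x m ((p : ℤ) - mu j - i + j) := by
    ext i j
    simp [Finset.sum_apply]
  rw [hrow]
  refine (MultilinearMap.map_sum_finset Matrix.detRowAlternating.toMultilinearMap
    (fun (i : Fin l) (p : ℕ) => x m ^ (lam i - p) •
      fun j : Fin l => completeHomogInt x m ((p : ℤ) - mu j - i + j))
    fun i => Icc (extendZero lam (i + 1)) (lam i)).trans ?_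
  refine sum_congr rfl fun nu hnu => ?_
  rw [MultilinearMap.map_smul_univ, smul_eq_mul, prod_pow_eq_pow_sum,
    sum_tsub_distrib (univ : Finset (Fin l)) fun i _ => (mem_stripSet.1 hnu i).2]
  rfl

/-- Without variables, the Jacobi-Trudi determinant only depends on whether the partitions agree. -/
theorem det_jacobiTrudi_zero (x : ℕ → R) {l : ℕ} {lam mu : Fin l → ℕ}
    (hlam : Antitone lam) (hmu : Antitone mu) :
    (jacobiTrudi x 0 lam mu).det = if lam = mu then 1 else 0 := by
  split_ifs with h
  · subst h
    convert Matrix.det_one (n := Fin l) (R := R)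
    ext i j
    rw [Matrix.one_apply, jacobiTrudi, Matrix.of_apply, completeHomogInt_zero]
    congr 1
    rw [eq_iff_iff]
    constructor
    · intro h0
      rcases lt_trichotomy i j with hij | hij | hij
      · have := hlam hij.le
        have : (i : ℕ) < j := hij
        omega
      · exact hij
      · have := hlam hij.le
        have : (j : ℕ) < i := hij
        omega
    · rintro rfl
      ring
  · by_contra hdet
    apply h
    -- At the first place where the partitions differ, a row or a column of the matrix is zero.
    suffices ∀ k (hk : k < l), lam ⟨k, hk⟩ = mu ⟨k, hk⟩ from funext fun i => this i i.2
    intro k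
    induction k using Nat.strong_induction_on with
    | _ k ih =>
      intro hk
      rcases lt_trichotomy (lam ⟨k, hk⟩) (mu ⟨k, hk⟩) with hlt | heq | hlt
      · refine absurd (Matrix.det_eq_zero_of_column_eq_zero ⟨k, hk⟩ fun i => ?_) hdet
        rw [jacobiTrudi, Matrix.of_apply, completeHomogInt_zero, if_neg]
        intro h0
        simp only at h0
        rcases lt_or_ge (i : ℕ) k with hik | hik
        · have h1 := ih i hik i.2
          have h2 : mu ⟨k, hk⟩ ≤ mu i := hmu (Fin.mk_le_mk.2 hik.le : i ≤ ⟨k, hk⟩)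
          simp only [Fin.eta] at h1
          omega
        · have h2 : lam i ≤ lam ⟨k, hk⟩ := hlam (Fin.mk_le_mk.2 hik : ⟨k, hk⟩ ≤ i)
          omega
      · exact heq
      · refine absurd (Matrix.det_eq_zero_of_row_eq_zero ⟨k, hk⟩ fun j => ?_) hdet
        rw [jacobiTrudi, Matrix.of_apply, completeHomogInt_zero, if_neg]
        intro h0
        simp only at h0
        rcases lt_or_ge (j : ℕ) k with hik | hik
        · have h1 := ih j hik j.2
          have h2 : lam ⟨k, hk⟩ ≤ lam j := hlam (Fin.mk_le_mk.2 hik.le : j ≤ ⟨k, hk⟩)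
          simp only [Fin.eta] at h1
          omega
        · have h2 : mu j ≤ mu ⟨k, hk⟩ := hmu (Fin.mk_le_mk.2 hik : ⟨k, hk⟩ ≤ j)
          omega

open Classical in
/-- The chains `mu = N 0, N 1, …, N m = lam` of partitions in which each step adds a horizontal
strip; they are continued by `lam`. -/
noncomputable def chains {l : ℕ} (mu : Fin l → ℕ) : ℕ → (Fin l → ℕ) → Finset (ℕ → Fin l → ℕ)
  | 0, lam => if lam = mu then {fun _ => lam} else ∅
  | m + 1, lam => (stripSet lam).biUnion fun nu =>
      (chains mu m nu).image fun N k => if k ≤ m then N k else lam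

theorem mem_chains {l : ℕ} {mu : Fin l → ℕ} {m : ℕ} {lam : Fin l → ℕ} {N : ℕ → Fin l → ℕ} :
    N ∈ chains mu m lam ↔
      N 0 = mu ∧ (∀ k < m, N k ∈ stripSet (N (k + 1))) ∧ ∀ k, m ≤ k → N k = lam := by
  induction m generalizing lam N with
  | zero =>
    simp only [chains, Nat.not_lt_zero, false_implies, implies_true, Nat.zero_le, true_and,
      forall_const]
    constructor
    · intro h
      split_ifs at h with hl
      · rw [mem_singleton] at h
        subst h
        exact ⟨hl, fun _ => rfl⟩
      · simp at h
    · rintro ⟨h0, h1⟩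
      rw [if_pos ((h1 0).symm.trans h0), mem_singleton]
      exact funext h1
  | succ m ih =>
    simp only [chains, mem_biUnion, mem_image]
    constructor
    · rintro ⟨nu, hnu, N, hN, rfl⟩
      obtain ⟨h0, h1, h2⟩ := ih.1 hN
      refine ⟨by simpa using h0, fun k hk => ?_, fun k hk => ?_⟩
      · rcases Nat.lt_succ_iff_lt_or_eq.1 hk with hk | rfl
        · simp only [hk.le, Nat.succ_le_of_lt hk, if_true]
          exact h1 k hk
        · simpa [h2 k le_rfl] using hnu
      · simp only [show ¬ k ≤ m by omega, if_false]
    · rintro ⟨h0, h1, h2⟩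
      have hs := h1 m (Nat.lt_succ_self m)
      rw [h2 (m + 1) le_rfl] at hs
      refine ⟨N m, hs, fun k => N (min k m), ih.2 ⟨by simpa using h0, fun k hk => ?_,
        fun k hk => by simp [hk]⟩, ?_⟩
      · simp only [min_eq_left hk.le, min_eq_left (Nat.succ_le_of_lt hk)]
        exact h1 k (by omega)
      · funext k
        split_ifs with hk
        · simp [hk]
        · exact (h2 k (by omega)).symm

theorem antitone_chains {l : ℕ} {mu : Fin l → ℕ} {m : ℕ} {lam : Fin l → ℕ} (hlam : Antitone lam)
    {N : ℕ → Fin l → ℕ} (hN : N ∈ chains mu m lam) (k : ℕ) : Antitone (N k) := by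
  obtain ⟨-, h1, h2⟩ := mem_chains.1 hN
  rcases lt_or_ge k m with hk | hk
  · exact antitone_of_mem_stripSet (h1 k hk)
  · rwa [h2 k hk]

/-- The Jacobi-Trudi determinant as a sum over chains of partitions. -/
theorem det_jacobiTrudi (x : ℕ → R) (m : ℕ) {l : ℕ} {lam mu : Fin l → ℕ}
    (hlam : Antitone lam) (hmu : Antitone mu) :
    (jacobiTrudi x m lam mu).det =
      ∑ N ∈ chains mu m lam, ∏ k ∈ range m, x k ^ (∑ i, N (k + 1) i - ∑ i, N k i) := by
  classical
  induction m generalizing lam with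
  | zero =>
    rw [det_jacobiTrudi_zero x hlam hmu, chains]
    split_ifs <;> simp
  | succ m ih =>
    rw [det_jacobiTrudi_succ x m mu hlam, chains, sum_biUnion]
    · refine sum_congr rfl fun nu hnu => ?_
      rw [ih (antitone_of_mem_stripSet hnu), sum_image, mul_sum]
      · refine sum_congr rfl fun N hN => ?_
        have hNm := (mem_chains.1 hN).2.2 m le_rfl
        rw [prod_range_succ, mul_comm]
        congr 1
        · refine prod_congr rfl fun k hk => ?_
          have hk := mem_range.1 hk
          simp only [hk.le, Nat.succ_le_of_lt hk, if_true]
        · simp [hNm]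
      · intro N hN N' hN' h
        funext k
        rcases le_or_gt k m with hk | hk
        · simpa [hk] using congrFun h k
        · rw [(mem_chains.1 hN).2.2 k hk.le, (mem_chains.1 hN').2.2 k hk.le]
    · intro nu _ nu' _ hne
      rw [Function.onFun, disjoint_left]
      intro N h h'
      obtain ⟨N₁, h₁, rfl⟩ := mem_image.1 h
      obtain ⟨N₂, h₂, h₃⟩ := mem_image.1 h'
      apply hne
      rw [← (mem_chains.1 h₁).2.2 m le_rfl, ← (mem_chains.1 h₂).2.2 m le_rfl]
      simpa using (congrFun h₃ m).symm

end JacobiTrudi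

/-! ### Words and their contents -/

/-- The content of a word: the exponent vector of the monomial that it becomes when the variables
are allowed to commute. -/
noncomputable def wordContent (w : List ℕ+) : ℕ+ →₀ ℕ := Multiset.toFinsupp (w : Multiset ℕ+)

theorem wordContent_apply (w : List ℕ+) (a : ℕ+) : wordContent w a = w.count a := by
  simp [wordContent]

theorem wordContent_append (u v : List ℕ+) :
    wordContent (u ++ v) = wordContent u + wordContent v := by
  ext a
  simp [wordContent_apply]

theorem wordContent_eq_iff {u v : List ℕ+} : wordContent u = wordContent v ↔ u.Perm v := by
  rw [wordContent, wordContent, EmbeddingLike.apply_eq_iff_eq, Multiset.coe_eq_coe]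

theorem degree_wordContent (w : List ℕ+) : (wordContent w).degree = w.length := by
  induction w with
  | nil => simp [wordContent]
  | cons a w ih =>
    have : wordContent (a :: w) = Finsupp.single a 1 + wordContent w := by
      rw [← List.singleton_append, wordContent_append]
      congr 1
      simp [wordContent]
    rw [this, map_add, ih, Finsupp.degree_single, List.length_cons, add_comm]

/-- The words of a given content. -/
noncomputable def wordsOf (α : ℕ+ →₀ ℕ) : Finset (List ℕ+) := (Multiset.lists (Finsupp.toMultiset α)).toFinset

theorem mem_wordsOf {α : ℕ+ →₀ ℕ} {w : List ℕ+} : w ∈ wordsOf α ↔ wordContent w = α := by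
  rw [wordsOf, Multiset.mem_toFinset, Multiset.mem_lists_iff, wordContent]
  constructor
  · intro h
    rw [← Multiset.quot_mk_to_coe, ← h, Finsupp.toMultiset_toFinsupp]
  · rintro rfl
    rw [Multiset.toFinsupp_toMultiset, Multiset.quot_mk_to_coe]

theorem exists_ofFn_eq {n : ℕ} {w : List ℕ+} (h : w.length = n) :
    ∃ i : Fin n → ℕ+, w = List.ofFn i := by
  subst h
  exact ⟨w.get, (List.ofFn_get w).symm⟩

theorem exists_wordContent_eq (α : ℕ+ →₀ ℕ) : ∃ w, wordContent w = α := by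
  obtain ⟨w, hw⟩ := Quot.exists_rep (Finsupp.toMultiset α)
  exact ⟨w, by rw [wordContent, ← Multiset.quot_mk_to_coe'', hw, Finsupp.toMultiset_toFinsupp]⟩

/-! ### Rearrangements of a word -/

section Rearrangements

variable {n : ℕ} {i v : Fin n → ℕ+}

/-- The number of the permutations of the places that fix the word `i`. -/
def stabCard (i : Fin n → ℕ+) : ℕ := #{g : Perm (Fin n) | i ∘ g = i}

theorem stabCard_pos (i : Fin n → ℕ+) : 0 < stabCard i :=
  card_pos.2 ⟨1, by simp⟩

theorem wordContent_ofFn_comp (i : Fin n → ℕ+) (g : Perm (Fin n)) :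
    wordContent (List.ofFn (i ∘ g)) = wordContent (List.ofFn i) :=
  wordContent_eq_iff.2 (g.ofFn_comp_perm i)

/-- A word indexed by `ι` can be read in any order `e` to find its content. -/
theorem wordContent_ofFn_apply {ι : Type*} [Fintype ι] (e : Fin n ≃ ι) (i : ι → ℕ+) (a : ℕ+) :
    wordContent (List.ofFn (i ∘ e)) a = Fintype.card {j // i j = a} := by
  classical
  have h : (List.ofFn (i ∘ e) : Multiset ℕ+) = (univ : Finset ι).val.map i := by
    rw [List.ofFn_eq_map, ← Multiset.map_coe, ← Multiset.map_map,
      ← Multiset.map_univ_val_equiv e, Fin.univ_def]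
  rw [wordContent, Multiset.toFinsupp_apply, h, Multiset.count_map, Fintype.card_subtype,
    ← card_val, filter_val]
  simp only [eq_comm]

theorem exists_perm_of_wordContent_eq
    (h : wordContent (List.ofFn i) = wordContent (List.ofFn v)) :
    ∃ g : Perm (Fin n), i ∘ g = v := by
  have e : ∀ a, Nonempty ({j // v j = a} ≃ {j // i j = a}) := fun a => by
    rw [← Fintype.card_eq, ← wordContent_ofFn_apply (Equiv.refl _) v,
      ← wordContent_ofFn_apply (Equiv.refl _) i]
    exact (DFunLike.congr_fun h a).symm
  exact ⟨ofFiberEquiv fun a => (e a).some, funext fun j => ofFiberEquiv_map _ j⟩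

/-- All rearrangements of a word arise from equally many permutations of its places. -/
theorem card_comp_eq_left (h : wordContent (List.ofFn i) = wordContent (List.ofFn v)) :
    #{g : Perm (Fin n) | i ∘ g = v} = stabCard i := by
  obtain ⟨g₀, rfl⟩ := exists_perm_of_wordContent_eq h
  refine card_bijective (fun g => g * g₀⁻¹) (Group.mulRight_bijective _) fun g => ?_
  simp only [mem_filter, mem_univ, true_and, funext_iff, Function.comp_apply, Perm.mul_apply]
  constructor
  · intro h j
    simpa using h (g₀⁻¹ j)
  · intro h j
    simpa using h (g₀ j)

theorem stabCard_eq_of_wordContent_eq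
    (h : wordContent (List.ofFn i) = wordContent (List.ofFn v)) : stabCard i = stabCard v := by
  obtain ⟨g₀, rfl⟩ := exists_perm_of_wordContent_eq h
  rw [← card_comp_eq_left h]
  refine card_bijective (fun g => g₀⁻¹ * g) (Group.mulLeft_bijective _) fun g => ?_
  simp [funext_iff, Perm.mul_apply]

/-- A sum over the permutations of the places of a word hits each rearrangement equally often. -/
theorem sum_perm_ofFn_comp (f : List ℕ+ → ℚ) (i : Fin n → ℕ+) :
    ∑ g : Perm (Fin n), f (List.ofFn (i ∘ g)) =
      stabCard i * ∑ w ∈ wordsOf (wordContent (List.ofFn i)), f w := by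
  rw [← sum_fiberwise_of_maps_to (s := univ) (g := fun g : Perm (Fin n) => List.ofFn (i ∘ g))
    (t := wordsOf (wordContent (List.ofFn i)))
    fun g _ => mem_wordsOf.2 (wordContent_ofFn_comp i g), mul_sum]
  refine sum_congr rfl fun w hw => ?_
  have hw' := mem_wordsOf.1 hw
  obtain ⟨v, rfl⟩ : ∃ v : Fin n → ℕ+, w = List.ofFn v :=
    exists_ofFn_eq (by rw [← degree_wordContent, hw', degree_wordContent, List.length_ofFn])
  rw [← card_comp_eq_left hw'.symm, sum_congr rfl fun g hg => by rw [(mem_filter.1 hg).2],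
    sum_const, nsmul_eq_mul]
  simp only [List.ofFn_inj]

end Rearrangements

/-! ### Letting the variables commute -/

open Classical in
/-- A word of content `α` that is cut in two is the same as a pair of words whose contents add up
to `α`; this makes `commSeries` multiplicative. -/
theorem sum_wordsOf_take_drop (f g : List ℕ+ → ℚ) (α : ℕ+ →₀ ℕ) :
    ∑ w ∈ wordsOf α, ∑ k ∈ range (w.length + 1), f (w.take k) * g (w.drop k) =
      ∑ p ∈ HasAntidiagonal.antidiagonal α,
        (∑ u ∈ wordsOf p.1, f u) * ∑ v ∈ wordsOf p.2, g v := by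
  simp only [sum_mul_sum, ← sum_product']
  rw [sum_sigma', sum_sigma']
  refine sum_bij' (fun x _ => ⟨(wordContent (x.1.take x.2), wordContent (x.1.drop x.2)),
      (x.1.take x.2, x.1.drop x.2)⟩)
    (fun y _ => ⟨y.2.1 ++ y.2.2, y.2.1.length⟩) ?_ ?_ ?_ ?_ ?_
  · rintro ⟨w, k⟩ h
    simp only [mem_sigma, mem_wordsOf] at h
    simp [mem_wordsOf, ← wordContent_append, h.1]
  · rintro ⟨⟨β, γ⟩, u, v⟩ h
    simp only [mem_sigma, HasAntidiagonal.mem_antidiagonal, mem_product, mem_wordsOf] at h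
    obtain ⟨h1, rfl, rfl⟩ := h
    simp only [mem_sigma, mem_wordsOf, wordContent_append, h1, true_and, mem_range,
      List.length_append]
    omega
  · rintro ⟨w, k⟩ h
    simp only [mem_sigma, mem_range] at h
    have := h.2
    simp
    omega
  · rintro ⟨⟨β, γ⟩, u, v⟩ h
    simp only [mem_sigma, HasAntidiagonal.mem_antidiagonal, mem_product, mem_wordsOf] at h
    obtain ⟨h1, rfl, rfl⟩ := h
    simp
  · rintro ⟨w, k⟩ h
    rfl

open Classical in
/-- The series in commuting variables that arises from `f` if the variables are allowed to commute
and those beyond the first `M` are set to `0`; see `commImage`. -/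
noncomputable def commSeries (M : ℕ) (f : NCPowerSeries) : MvPowerSeries ℕ+ ℚ :=
  fun α => if ∀ a ∈ α.support, (a : ℕ) ≤ M then ∑ w ∈ wordsOf α, f w else 0

open Classical in
theorem coeff_commSeries (M : ℕ) (f : NCPowerSeries) (α : ℕ+ →₀ ℕ) :
    MvPowerSeries.coeff α (commSeries M f) =
      if ∀ a ∈ α.support, (a : ℕ) ≤ M then ∑ w ∈ wordsOf α, f w else 0 := rfl

theorem commSeries_mul (M : ℕ) (f g : NCPowerSeries) :
    commSeries M (f * g) = commSeries M f * commSeries M g := by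
  classical
  ext α
  rw [MvPowerSeries.coeff_mul, coeff_commSeries]
  simp only [coeff_commSeries]
  split_ifs with h
  · refine (sum_wordsOf_take_drop f g α).trans (sum_congr rfl fun p hp => ?_)
    rw [HasAntidiagonal.mem_antidiagonal] at hp
    rw [if_pos, if_pos]
    · intro a ha
      refine h a ?_
      simp only [← hp, Finsupp.mem_support_iff, Finsupp.add_apply] at ha ⊢
      omega
    · intro a ha
      refine h a ?_
      simp only [← hp, Finsupp.mem_support_iff, Finsupp.add_apply] at ha ⊢
      omega
  · refine (sum_eq_zero fun p hp => ?_).symm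
    rw [HasAntidiagonal.mem_antidiagonal] at hp
    push Not at h
    obtain ⟨a, ha, hM⟩ := h
    have : a ∈ p.1.support ∨ a ∈ p.2.support := by
      simp only [← hp, Finsupp.mem_support_iff, Finsupp.add_apply] at ha ⊢
      omega
    rcases this with ha | ha
    · rw [if_neg fun h => (h a ha).not_gt hM, zero_mul]
    · rw [if_neg (c := ∀ a ∈ p.2.support, _) fun h => (h a ha).not_gt hM, mul_zero]

theorem commSeries_one (M : ℕ) : commSeries M 1 = 1 := by
  classical
  ext α
  rw [MvPowerSeries.coeff_one, coeff_commSeries]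
  simp only [NCPowerSeries.one_apply]
  have hnil : wordContent [] = 0 := by simp [wordContent]
  by_cases h : α = 0
  · subst h
    simp [mem_wordsOf, hnil]
  · simp [mem_wordsOf, hnil, h, Ne.symm h]

theorem commSeries_add (M : ℕ) (f g : NCPowerSeries) :
    commSeries M (f + g) = commSeries M f + commSeries M g := by
  classical
  ext α
  rw [map_add]
  simp only [coeff_commSeries, NCPowerSeries.add_apply]
  split_ifs
  · exact sum_add_distrib
  · simp

/-- The ring homomorphism that lets the variables commute and sets those beyond the first `M`
to `0`. The truncation makes the complete homogeneous functions polynomials. -/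
noncomputable def commImage (M : ℕ) : NCPowerSeries →+* MvPowerSeries ℕ+ ℚ :=
  { AddMonoidHom.mk' (commSeries M) (commSeries_add M) with
    map_one' := commSeries_one M
    map_mul' := commSeries_mul M }

open Classical in
theorem coeff_commImage (M : ℕ) (f : NCPowerSeries) (α : ℕ+ →₀ ℕ) :
    MvPowerSeries.coeff α (commImage M f) =
      if ∀ a ∈ α.support, (a : ℕ) ≤ M then ∑ w ∈ wordsOf α, f w else 0 := rfl

/-- The commuting variables, indexed from `0`. -/
noncomputable def commVar (k : ℕ) : MvPowerSeries ℕ+ ℚ := MvPowerSeries.X k.succPNat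

open Classical in
/-- The complete homogeneous polynomial is the sum of all monomials of its degree. -/
theorem coeff_completeHomog (m k : ℕ) (α : ℕ+ →₀ ℕ) :
    MvPowerSeries.coeff α (completeHomog commVar m k) =
      if α.degree = k ∧ ∀ a ∈ α.support, (a : ℕ) ≤ m then 1 else 0 := by
  induction m generalizing k α with
  | zero =>
    rw [completeHomog, apply_ite (MvPowerSeries.coeff α), MvPowerSeries.coeff_one, map_zero,
      ← ite_and]
    congr 1
    rw [eq_iff_iff]
    constructor
    · rintro ⟨rfl, rfl⟩
      simp
    · rintro ⟨rfl, h⟩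
      have : α = 0 := by
        ext a
        by_contra ha
        exact absurd (h a (Finsupp.mem_support_iff.2 ha)) (by simp)
      subst this
      simp
  | succ m ih =>
    have hterm : ∀ j ∈ range (k + 1), MvPowerSeries.coeff α
        (commVar m ^ (k - j) * completeHomog commVar m j) =
        if (α.degree = k ∧ ∀ a ∈ α.support, (a : ℕ) ≤ m + 1) ∧ j = k - α m.succPNat
        then 1 else 0 := by
      intro j hj
      rw [mem_range] at hj
      rw [commVar, MvPowerSeries.X_pow_eq, MvPowerSeries.coeff_monomial_mul, one_mul, ih, ← ite_and]
      congr 1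
      rw [eq_iff_iff]
      constructor
      · rintro ⟨hle, hdeg, hsupp⟩
        obtain ⟨β, rfl⟩ := exists_add_of_le hle
        rw [add_tsub_cancel_left] at hdeg hsupp
        refine ⟨⟨?_, fun a ha => ?_⟩, ?_⟩
        · rw [map_add, Finsupp.degree_single, hdeg]
          omega
        · by_cases hβ : a ∈ β.support
          · exact (hsupp a hβ).trans (Nat.le_succ m)
          · rcases Finset.mem_union.1 (Finsupp.support_add ha) with h | h
            · rw [mem_singleton.1 (Finsupp.support_single_subset h)]
              simp
            · exact absurd h hβ
        · have h0 : β m.succPNat = 0 := by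
            by_contra h
            have := hsupp _ (Finsupp.mem_support_iff.2 h)
            simp at this
          simp [h0]
          omega
      · rintro ⟨⟨hdeg, hsupp⟩, rfl⟩
        have hk : α m.succPNat ≤ k := hdeg ▸ Finsupp.le_degree _ _
        rw [Nat.sub_sub_self hk]
        have hle : Finsupp.single m.succPNat (α m.succPNat) ≤ α :=
          Finsupp.single_le_iff.2 le_rfl
        refine ⟨hle, ?_, fun a ha => ?_⟩
        · have := congrArg Finsupp.degree (tsub_add_cancel_of_le hle)
          rw [map_add, Finsupp.degree_single] at this
          omega
        · rw [Finsupp.mem_support_iff, Finsupp.tsub_apply] at ha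
          have hne : a ≠ m.succPNat := by
            rintro rfl
            simp at ha
          have h1 := hsupp a (Finsupp.mem_support_iff.2 fun h => ha (by simp [h]))
          have h2 : (a : ℕ) ≠ m + 1 := fun h => hne (PNat.eq h)
          omega
    rw [completeHomog, map_sum, sum_congr rfl hterm]
    simp only [ite_and]
    split_ifs <;> simp

/-! ### The images of the complete homogeneous functions -/

section Kernel

variable {n : ℕ}

/-- The blocks of the set partition that a word determines are its nonempty fibres. -/
theorem parts_eq_image_fibers {σ : SetPartition n} {i : Fin n → ℕ+}
    (h : ∀ j k, i j = i k ↔ ∃ B ∈ σ.parts, j ∈ B ∧ k ∈ B) :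
    σ.parts = (univ.image i).image fun a => ({j | i j = a} : Finset (Fin n)) := by
  have key : ∀ B ∈ σ.parts, ∀ j ∈ B, ({k | i k = i j} : Finset (Fin n)) = B := by
    intro B hB j hj
    ext k
    simp only [mem_filter, mem_univ, true_and, h]
    constructor
    · rintro ⟨C, hC, hk, hj'⟩
      rwa [σ.eq_of_mem_parts hB hC hj hj']
    · exact fun hk => ⟨B, hB, hk, hj⟩
  ext B
  simp only [mem_image, mem_univ, true_and, exists_exists_eq_and]
  constructor
  · intro hB
    obtain ⟨j, hj⟩ := σ.nonempty_of_mem_parts hB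
    exact ⟨j, key B hB j hj⟩
  · rintro ⟨j, rfl⟩
    obtain ⟨B, hB, hj⟩ := σ.exists_mem (mem_univ j)
    rwa [key B hB j hj]

/-- The permutations that fix a word are those that permute the places of each letter. -/
theorem blockFactorial_eq_stabCard {σ : SetPartition n} {i : Fin n → ℕ+}
    (h : ∀ j k, i j = i k ↔ ∃ B ∈ σ.parts, j ∈ B ∧ k ∈ B) :
    blockFactorial σ = stabCard i := by
  have hs : stabCard i = Fintype.card {g : Perm (Fin n) // i ∘ g = i} := by
    rw [Fintype.card_subtype, stabCard]
  rw [hs, DomMulAct.stabilizer_card', blockFactorial, parts_eq_image_fibers h, prod_image]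
  · exact prod_congr rfl fun a _ => by rw [Fintype.card_subtype]
  · intro a ha b _ hab
    obtain ⟨j, -, rfl⟩ := mem_image.1 ha
    simp only at hab
    have : j ∈ ({k | i k = i j} : Finset (Fin n)) := by simp
    rw [hab] at this
    simpa using this

/-- Each word belongs to some `m_σ`; the blocks of `σ` are the sets of places with equal letters. -/
theorem exists_kernel (i : Fin n → ℕ+) :
    ∃ σ : SetPartition n, ∀ j k, i j = i k ↔ ∃ B ∈ σ.parts, j ∈ B ∧ k ∈ B := by
  classical
  refine ⟨Finpartition.ofSetoid (Setoid.ker i), fun j k => ?_⟩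
  rw [← Finpartition.mem_part_iff_exists, Finpartition.mem_part_ofSetoid_iff_rel, Setoid.ker_def,
    eq_comm]

theorem ncMonomial_eq_zero_of_length_ne (σ : SetPartition n) {w : List ℕ+} (h : w.length ≠ n) :
    ncMonomial σ w = 0 := by
  refine if_neg ?_
  rintro ⟨i, rfl, -⟩
  simp at h

theorem ncComplete_apply (π : SetPartition n) (w : List ℕ+) :
    ncComplete π w = ∑ σ, (blockFactorial (σ ⊓ π) : ℚ) * ncMonomial σ w :=
  NCPowerSeries.sum_apply _ _ w

theorem ncComplete_eq_zero_of_length_ne (π : SetPartition n) {w : List ℕ+} (h : w.length ≠ n) :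
    ncComplete π w = 0 := by
  rw [ncComplete_apply]
  exact sum_eq_zero fun σ _ => by rw [ncMonomial_eq_zero_of_length_ne σ h, mul_zero]

theorem ncComplete_top_ofFn (i : Fin n → ℕ+) :
    ncComplete (⊤ : SetPartition n) (List.ofFn i) = stabCard i := by
  obtain ⟨σ, hσ⟩ := exists_kernel i
  rw [ncComplete_apply, sum_eq_single σ]
  · have : ncMonomial σ (List.ofFn i) = 1 := if_pos ⟨i, rfl, hσ⟩
    rw [this, mul_one, inf_top_eq, blockFactorial_eq_stabCard hσ]
  · intro τ _ hne
    have : ncMonomial τ (List.ofFn i) = 0 := by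
      refine if_neg ?_
      rintro ⟨j, hj, hτ⟩
      obtain rfl := List.ofFn_injective hj
      exact hne (Finpartition.ext (by rw [parts_eq_image_fibers hτ, parts_eq_image_fibers hσ]))
    rw [this, mul_zero]
  · simp

end Kernel

/-- The factor `1 / k!` is the one that makes the commutative image of `h_{[k]}` the complete
homogeneous polynomial: the coefficient of each word in `h_{[k]}` is the number of the permutations
that fix it, and the sum of these numbers over the rearrangements of a word is `k!`. -/
theorem commImage_scaledComplete (M : ℕ) (k : ℤ) :
    commImage M (scaledComplete k) = completeHomogInt commVar M k := by
  classical
  cases k with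
  | negSucc k => exact map_zero _
  | ofNat k =>
    ext α
    change MvPowerSeries.coeff α (commImage M ((1 / (k ! : ℚ)) • ncComplete (⊤ : SetPartition k)))
      = MvPowerSeries.coeff α (completeHomog commVar M k)
    rw [coeff_completeHomog, coeff_commImage]
    suffices h : ∑ w ∈ wordsOf α, (1 / (k ! : ℚ)) * ncComplete (⊤ : SetPartition k) w =
        if α.degree = k then 1 else 0 by
      by_cases hM : ∀ a ∈ α.support, (a : ℕ) ≤ M
      · rw [if_pos hM]
        exact h.trans (if_congr (and_iff_left hM).symm rfl rfl)
      · rw [if_neg hM, if_neg fun h => hM h.2]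
    refine (mul_sum (wordsOf α) (ncComplete (⊤ : SetPartition k)) (1 / (k ! : ℚ))).symm.trans ?_
    split_ifs with hk
    · obtain ⟨w, rfl⟩ := exists_wordContent_eq α
      obtain ⟨i, rfl⟩ := exists_ofFn_eq ((degree_wordContent w).symm.trans hk)
      have key := sum_perm_ofFn_comp (ncComplete (⊤ : SetPartition k)) i
      simp only [ncComplete_top_ofFn] at key
      rw [sum_congr rfl fun g _ => by
          rw [stabCard_eq_of_wordContent_eq (wordContent_ofFn_comp i g)],
        sum_const, card_univ, Fintype.card_perm, Fintype.card_fin, nsmul_eq_mul, mul_comm] at key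
      have hpos : (stabCard i : ℚ) ≠ 0 := Nat.cast_ne_zero.2 (stabCard_pos i).ne'
      rw [← mul_left_cancel₀ hpos key]
      field_simp
    · refine mul_eq_zero_of_right _ (sum_eq_zero fun w hw => ?_)
      refine ncComplete_eq_zero_of_length_ne _ fun h => hk ?_
      rw [← mem_wordsOf.1 hw, degree_wordContent, h]

/-- Over a commutative ring, `ncDet` is the determinant. -/
theorem map_ncDet {R S : Type*} [Ring R] [CommRing S] (f : R →+* S) {l : ℕ}
    (A : Matrix (Fin l) (Fin l) R) : f (ncDet A) = (Matrix.of fun i j => f (A i j)).det := by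
  rw [ncDet, map_sum, ← Matrix.det_transpose, Matrix.det_apply]
  refine sum_congr rfl fun ε _ => ?_
  rw [map_zsmul, map_list_prod, List.map_ofFn, List.prod_ofFn, Units.smul_def]
  rfl

/-! ### Homogeneity -/

/-- All monomials of `f` have the degree `k`. -/
def NCPowerSeries.IsHomogeneous (f : NCPowerSeries) (k : ℤ) : Prop :=
  ∀ w : List ℕ+, (w.length : ℤ) ≠ k → f w = 0

theorem scaledComplete_isHomogeneous (k : ℤ) : (scaledComplete k).IsHomogeneous k := by
  intro w hw
  cases k with
  | negSucc k => rfl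
  | ofNat k =>
    change (1 / (k ! : ℚ)) * ncComplete (⊤ : SetPartition k) w = 0
    rw [ncComplete_eq_zero_of_length_ne _ fun h => hw (by rw [h]; rfl), mul_zero]

theorem NCPowerSeries.IsHomogeneous.mul {f g : NCPowerSeries} {a b : ℤ} (hf : f.IsHomogeneous a)
    (hg : g.IsHomogeneous b) : (f * g).IsHomogeneous (a + b) := by
  intro w hw
  rw [NCPowerSeries.mul_apply]
  refine sum_eq_zero fun k hk => ?_
  rw [mem_range] at hk
  by_cases h : ((w.take k).length : ℤ) = a
  · rw [hg, mul_zero]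
    rw [List.length_take] at h
    rw [List.length_drop]
    omega
  · rw [hf _ h, zero_mul]

theorem NCPowerSeries.isHomogeneous_prod_ofFn {l : ℕ} (F : Fin l → NCPowerSeries) (d : Fin l → ℤ)
    (h : ∀ i, (F i).IsHomogeneous (d i)) : (List.ofFn F).prod.IsHomogeneous (∑ i, d i) := by
  induction l with
  | zero =>
    intro w hw
    rw [List.ofFn_zero, List.prod_nil, NCPowerSeries.one_apply, if_neg]
    rintro rfl
    simp at hw
  | succ l ih =>
    rw [List.ofFn_succ, List.prod_cons, Fin.sum_univ_succ]
    exact (h 0).mul (ih _ _ fun i => h i.succ)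

/-! ### The rows of a skew diagram -/

namespace SkewDiagram

variable (D : SkewDiagram)

/-- The number of the rows of `λ`, empty rows of `λ/μ` included. -/
abbrev numRows : ℕ := D.outer.colLen 0

/-- The parts of `λ`. -/
def outerPart (i : Fin D.numRows) : ℕ := D.outer.rowLen i

/-- The first parts of `μ`, as many as `λ` has. -/
def innerPart (i : Fin D.numRows) : ℕ := D.inner.rowLen i

theorem antitone_outerPart : Antitone D.outerPart := fun _ _ h => D.outer.rowLen_anti _ _ h

theorem antitone_innerPart : Antitone D.innerPart := fun _ _ h => D.inner.rowLen_anti _ _ h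

theorem mem_boxes {b : ℕ × ℕ} :
    b ∈ D.boxes ↔ D.inner.rowLen b.1 ≤ b.2 ∧ b.2 < D.outer.rowLen b.1 := by
  obtain ⟨i, c⟩ := b
  rw [boxes, mem_sdiff, YoungDiagram.mem_cells, YoungDiagram.mem_cells,
    YoungDiagram.mem_iff_lt_rowLen, YoungDiagram.mem_iff_lt_rowLen, not_lt, and_comm]

theorem innerPart_le_outerPart (i : Fin D.numRows) : D.innerPart i ≤ D.outerPart i := by
  by_contra! h
  have h1 : ((i : ℕ), D.outer.rowLen i) ∈ D.inner := YoungDiagram.mem_iff_lt_rowLen.2 h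
  exact lt_irrefl _ (YoungDiagram.mem_iff_lt_rowLen.1 (D.inner_le h1))

variable {D}

/-- The row of a box. -/
def boxRow (b : D.Box) : Fin D.numRows :=
  ⟨b.1.1, YoungDiagram.mem_iff_lt_colLen.1
    (D.outer.up_left_mem le_rfl (Nat.zero_le _) (mem_sdiff.1 b.2).1)⟩

theorem innerPart_le_col (b : D.Box) : D.innerPart (boxRow b) ≤ b.1.2 := (D.mem_boxes.1 b.2).1

theorem col_lt_outerPart (b : D.Box) : b.1.2 < D.outerPart (boxRow b) := (D.mem_boxes.1 b.2).2

/-- The box in row `i` and column `c`. -/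
def mkBox (i : Fin D.numRows) (c : ℕ) (h : D.innerPart i ≤ c) (h' : c < D.outerPart i) : D.Box :=
  ⟨(i, c), D.mem_boxes.2 ⟨h, h'⟩⟩

theorem card_row_lt (i : Fin D.numRows) {t : ℕ} (ht : t ≤ D.outerPart i) :
    #{b : D.Box | boxRow b = i ∧ b.1.2 < t} = t - D.innerPart i := by
  rw [← Nat.card_Ico]
  refine card_bij (fun b _ => b.1.2) (fun b hb => ?_) (fun b hb b' hb' h => ?_) fun c hc => ?_
  · simp only [mem_filter, mem_univ, true_and] at hb
    obtain ⟨rfl, hb⟩ := hb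
    exact mem_Ico.2 ⟨innerPart_le_col b, hb⟩
  · simp only [mem_filter, mem_univ, true_and] at hb hb'
    exact Subtype.ext (Prod.ext (congrArg Fin.val (hb.1.trans hb'.1.symm)) h)
  · rw [mem_Ico] at hc
    exact ⟨mkBox i c hc.1 (hc.2.trans_le ht), mem_filter.2 ⟨mem_univ _, rfl, hc.2⟩, rfl⟩

theorem card_eq_sum_card_rows (p : D.Box → Prop) [DecidablePred p] :
    #{b : D.Box | p b} = ∑ i, #{b : D.Box | boxRow b = i ∧ p b} := by
  rw [card_eq_sum_card_fiberwise (f := boxRow) (t := univ) fun _ _ => mem_coe.2 (mem_univ _)]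
  refine sum_congr rfl fun i _ => ?_
  rw [filter_filter]
  simp only [and_comm]

variable (D) in
theorem sum_outerPart : ∑ i, D.outerPart i = ∑ i, D.innerPart i + D.size := by
  have h := card_eq_sum_card_rows (D := D) fun _ => True
  have h2 : ∀ i, #{b : D.Box | boxRow b = i ∧ True} = D.outerPart i - D.innerPart i := fun i => by
    rw [← card_row_lt i le_rfl]
    congr 1
    ext b
    simp only [mem_filter, mem_univ, true_and, and_true]
    refine ⟨?_, fun h => h.1⟩
    rintro rfl
    exact ⟨rfl, col_lt_outerPart b⟩
  simp only [h2] at h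
  have hs : D.size = #{b : D.Box | True} := by
    simp [SkewDiagram.size]
  rw [hs, h, ← sum_add_distrib]
  exact sum_congr rfl fun i _ => by have := D.innerPart_le_outerPart i; omega

end SkewDiagram

open SkewDiagram

/-! ### Semistandard tableaux as chains of partitions -/

namespace SkewSSYT

variable {D : SkewDiagram}

theorem entry_injective : Function.Injective (SkewSSYT.entry (D := D)) := by
  rintro ⟨f, _, _⟩ ⟨g, _, _⟩ rfl
  rfl

/-- The row lengths of the partition formed by `μ` and the boxes with the entries `1, …, m`. -/
def shapeUpTo (T : SkewSSYT D) (m : ℕ) (i : Fin D.numRows) : ℕ :=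
  D.innerPart i + #{b : D.Box | boxRow b = i ∧ (T.entry b : ℕ) ≤ m}

/-- As the rows increase weakly, the boxes with the entries `1, …, m` form an initial segment of
each row, and so the partitions `shapeUpTo` determine the tableau. -/
theorem entry_le_iff (T : SkewSSYT D) (b : D.Box) (m : ℕ) :
    (T.entry b : ℕ) ≤ m ↔ b.1.2 < T.shapeUpTo m (boxRow b) := by
  have hb := innerPart_le_col b
  rw [shapeUpTo]
  constructor
  · intro h
    have hsub : univ.filter (fun b' : D.Box => boxRow b' = boxRow b ∧ b'.1.2 < b.1.2 + 1) ⊆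
        univ.filter fun b' => boxRow b' = boxRow b ∧ (T.entry b' : ℕ) ≤ m := by
      intro b' hb'
      simp only [mem_filter, mem_univ, true_and] at hb' ⊢
      refine ⟨hb'.1, le_trans ?_ h⟩
      have hrow : b'.1.1 = b.1.1 := congrArg Fin.val hb'.1
      rcases Nat.lt_succ_iff_lt_or_eq.1 hb'.2 with hlt | heq
      · exact T.row_weak b' b hrow hlt
      · rw [show b' = b from Subtype.ext (Prod.ext hrow heq)]
    have := card_le_card hsub
    rw [card_row_lt _ (Nat.succ_le_of_lt (col_lt_outerPart b))] at this
    omega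
  · intro h
    by_contra! hm
    have hsub : univ.filter (fun b' : D.Box => boxRow b' = boxRow b ∧ (T.entry b' : ℕ) ≤ m) ⊆
        univ.filter fun b' => boxRow b' = boxRow b ∧ b'.1.2 < b.1.2 := by
      intro b' hb'
      simp only [mem_filter, mem_univ, true_and] at hb' ⊢
      refine ⟨hb'.1, ?_⟩
      by_contra! hle
      have hrow : b'.1.1 = b.1.1 := congrArg Fin.val hb'.1
      rcases hle.lt_or_eq with hlt | heq
      · have : (T.entry b : ℕ) ≤ T.entry b' := T.row_weak b b' hrow.symm hlt
        omega
      · rw [show b' = b from Subtype.ext (Prod.ext hrow heq.symm)] at hb'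
        omega
    have := card_le_card hsub
    rw [card_row_lt _ (col_lt_outerPart b).le] at this
    omega

/-- The equivalence in `entry_le_iff` characterizes `shapeUpTo`. -/
theorem shapeUpTo_eq_of_forall (T : SkewSSYT D) {m t : ℕ} {i : Fin D.numRows}
    (ht : D.innerPart i ≤ t) (ht' : t ≤ D.outerPart i)
    (h : ∀ b : D.Box, boxRow b = i → ((T.entry b : ℕ) ≤ m ↔ b.1.2 < t)) :
    T.shapeUpTo m i = t := by
  have : univ.filter (fun b : D.Box => boxRow b = i ∧ (T.entry b : ℕ) ≤ m) =
      univ.filter fun b => boxRow b = i ∧ b.1.2 < t := by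
    ext b
    simp only [mem_filter, mem_univ, true_and]
    exact and_congr_right (h b)
  rw [shapeUpTo, this, card_row_lt i ht']
  omega

theorem shapeUpTo_le_outerPart (T : SkewSSYT D) (m : ℕ) (i : Fin D.numRows) :
    T.shapeUpTo m i ≤ D.outerPart i := by
  have hsub : univ.filter (fun b : D.Box => boxRow b = i ∧ (T.entry b : ℕ) ≤ m) ⊆
      univ.filter fun b => boxRow b = i ∧ b.1.2 < D.outerPart i := by
    intro b hb
    simp only [mem_filter, mem_univ, true_and] at hb ⊢
    obtain ⟨rfl, -⟩ := hb
    exact ⟨rfl, col_lt_outerPart b⟩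
  have := card_le_card hsub
  rw [card_row_lt i le_rfl] at this
  have := D.innerPart_le_outerPart i
  rw [shapeUpTo]
  omega

/-- The columns increase strictly if and only if each step of the chain adds a horizontal strip;
this is the direction from the tableau to the chain. -/
theorem shapeUpTo_mem_chains (T : SkewSSYT D) {M : ℕ} (hM : ∀ b, (T.entry b : ℕ) ≤ M) :
    T.shapeUpTo ∈ chains D.innerPart M D.outerPart := by
  refine mem_chains.2 ⟨?_, fun k _ => mem_stripSet.2 fun i => ⟨?_, ?_⟩, fun k hk => ?_⟩
  · funext i
    refine T.shapeUpTo_eq_of_forall le_rfl (D.innerPart_le_outerPart i) ?_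
    rintro b rfl
    have := (T.entry b).pos
    have := innerPart_le_col b
    omega
  · -- A box of row `i + 1` that violates the inequality would lie below a box with an entry
    -- at least as large.
    unfold extendZero
    split_ifs with hi
    · by_contra! hlt
      set i' : Fin D.numRows := ⟨i + 1, hi⟩
      have h1 : D.innerPart i ≤ T.shapeUpTo k i := Nat.le_add_right _ _
      have hii' : i ≤ i' := Fin.mk_le_mk.2 (Nat.le_succ _)
      have h2 := D.antitone_innerPart hii'
      have h3 := D.antitone_outerPart hii'
      have h4 := T.shapeUpTo_le_outerPart (k + 1) i'
      let b := mkBox i (T.shapeUpTo k i) h1 (by omega)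
      let b' := mkBox i' (T.shapeUpTo k i) (by omega) (by omega)
      have h5 : (T.entry b' : ℕ) ≤ k + 1 := (T.entry_le_iff b' (k + 1)).2 hlt
      have h6 : (T.entry b : ℕ) < T.entry b' := T.col_strict b b' rfl (Nat.lt_succ_self _)
      have h7 : T.shapeUpTo k i < T.shapeUpTo k i :=
        (T.entry_le_iff b k).1 (by omega)
      exact lt_irrefl _ h7
    · exact Nat.zero_le _
  · refine Nat.add_le_add_left (card_le_card fun b hb => ?_) _
    simp only [mem_filter, mem_univ, true_and] at hb ⊢
    exact ⟨hb.1, hb.2.trans (Nat.le_succ k)⟩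
  · funext i
    refine T.shapeUpTo_eq_of_forall (D.innerPart_le_outerPart i) le_rfl ?_
    rintro b rfl
    exact iff_of_true ((hM b).trans hk) (col_lt_outerPart b)

theorem shapeUpTo_injective : Function.Injective (shapeUpTo (D := D)) := by
  intro T T' h
  refine entry_injective (funext fun b => PNat.eq ?_)
  refine eq_of_forall_ge_iff fun m => ?_
  rw [entry_le_iff, entry_le_iff, h]

/-- Every chain of partitions from `μ` to `λ` arises from a tableau: the entry of a box is the
number of the first partition of the chain that contains it. -/
theorem exists_shapeUpTo_eq {M : ℕ} {N : ℕ → Fin D.numRows → ℕ}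
    (hN : N ∈ chains D.innerPart M D.outerPart) :
    ∃ T : SkewSSYT D, T.shapeUpTo = N ∧ ∀ b, (T.entry b : ℕ) ≤ M := by
  obtain ⟨h0, hstrip, hlast⟩ := mem_chains.1 hN
  have hstep : ∀ k i, N k i ≤ N (k + 1) i := fun k i => by
    rcases lt_or_ge k M with hk | hk
    · exact (mem_stripSet.1 (hstrip k hk) i).2
    · rw [hlast k hk, hlast (k + 1) (by omega)]
  have hmono : ∀ i, Monotone fun k => N k i := fun i => monotone_nat_of_le_succ fun k => hstep k i
  have hex : ∀ b : D.Box, ∃ k, b.1.2 < N k (boxRow b) := fun b =>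
    ⟨M, by rw [hlast M le_rfl]; exact col_lt_outerPart b⟩
  have hpos : ∀ b : D.Box, 0 < Nat.find (hex b) := fun b => by
    rw [Nat.find_pos, h0, not_lt]
    exact innerPart_le_col b
  have hle : ∀ (b : D.Box) (k : ℕ), Nat.find (hex b) ≤ k ↔ b.1.2 < N k (boxRow b) := fun b k =>
    ⟨fun h => (Nat.find_spec (hex b)).trans_le (hmono _ h), fun h => Nat.find_min' _ h⟩
  let T : SkewSSYT D :=
    { entry := fun b => ⟨Nat.find (hex b), hpos b⟩
      row_weak := fun b c hrow hcol => by
        have hrow' : boxRow b = boxRow c := Fin.ext hrow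
        change Nat.find (hex b) ≤ Nat.find (hex c)
        rw [hle, hrow']
        exact hcol.trans (Nat.find_spec (hex c))
      col_strict := fun b c hcol hrow => by
        change Nat.find (hex b) < Nat.find (hex c)
        -- Let `k + 1` be the entry of `c`. The box just below `b` lies in the partition
        -- `N (k + 1)`, and so `b` lies in `N k`.
        obtain ⟨k, hk⟩ := Nat.exists_eq_succ_of_ne_zero (hpos c).ne'
        rw [hk, Nat.lt_succ_iff, hle, hcol]
        have hc : c.1.2 < N (k + 1) (boxRow c) := (hle c (k + 1)).1 hk.le
        have hkM : k < M := by
          have := Nat.find_min' (hex c) (by rw [hlast M le_rfl]; exact col_lt_outerPart c)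
          omega
        have hi : (boxRow b : ℕ) + 1 < D.numRows :=
          lt_of_le_of_lt (Nat.succ_le_of_lt hrow) (boxRow c).2
        have h1 := (mem_stripSet.1 (hstrip k hkM) (boxRow b)).1
        rw [extendZero, dif_pos hi] at h1
        refine hc.trans_le (le_trans ?_ h1)
        exact antitone_chains D.antitone_outerPart hN (k + 1)
          (Fin.mk_le_mk.2 (Nat.succ_le_of_lt hrow) : (⟨boxRow b + 1, hi⟩ : Fin _) ≤ boxRow c) }
  refine ⟨T, funext fun k => funext fun i => T.shapeUpTo_eq_of_forall ?_ ?_ ?_, fun b => ?_⟩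
  · rw [← h0]
    exact hmono i (Nat.zero_le k)
  · rw [← hlast (max k M) (le_max_right _ _)]
    exact hmono i (le_max_left _ _)
  · rintro b rfl
    exact hle b k
  · exact (hle b M).2 (by rw [hlast M le_rfl]; exact col_lt_outerPart b)

/-- The content of a tableau: how often each number occurs as an entry. -/
noncomputable def content (T : SkewSSYT D) : ℕ+ →₀ ℕ :=
  wordContent (List.ofFn (T.entry ∘ D.readingOrder))

theorem content_apply (T : SkewSSYT D) (a : ℕ+) : T.content a = #{b : D.Box | T.entry b = a} := by
  rw [content, wordContent_ofFn_apply, Fintype.card_subtype]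

theorem entry_mem_support_content (T : SkewSSYT D) (b : D.Box) :
    T.entry b ∈ T.content.support := by
  rw [Finsupp.mem_support_iff, content_apply]
  exact (card_pos.2 ⟨b, by simp⟩).ne'

/-- The entries `k + 1` fill the `k`-th strip of the chain, counted from `0`. -/
theorem content_eq_sub (T : SkewSSYT D) (k : ℕ) :
    T.content k.succPNat = ∑ i, T.shapeUpTo (k + 1) i - ∑ i, T.shapeUpTo k i := by
  have h : ∀ m, ∑ i, T.shapeUpTo m i =
      ∑ i, D.innerPart i + #{b : D.Box | (T.entry b : ℕ) ≤ m} := fun m => by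
    rw [card_eq_sum_card_rows, ← sum_add_distrib]
    rfl
  have h2 : #{b : D.Box | (T.entry b : ℕ) ≤ k + 1} =
      #{b : D.Box | (T.entry b : ℕ) ≤ k} + #{b : D.Box | T.entry b = k.succPNat} := by
    rw [← card_union_of_disjoint]
    · congr 1
      ext b
      simp only [mem_filter, mem_univ, true_and, mem_union, ← PNat.coe_inj, Nat.succPNat_coe]
      omega
    · rw [disjoint_filter]
      intro b _ hb hb'
      rw [hb', Nat.succPNat_coe] at hb
      omega
  rw [h, h, h2, content_apply]
  omega

end SkewSSYT

/-! ### Coefficients of the Jacobi-Trudi determinant -/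

/-- A chain contributes to the Jacobi-Trudi determinant the monomial of its size differences. -/
theorem prod_commVar_pow (e : ℕ → ℕ) (M : ℕ) :
    ∏ k ∈ range M, commVar k ^ e k =
      MvPowerSeries.monomial (∑ k ∈ range M, Finsupp.single k.succPNat (e k)) 1 := by
  induction M with
  | zero => simp [MvPowerSeries.monomial_zero_one]
  | succ M ih =>
    rw [prod_range_succ, sum_range_succ, ih, commVar, MvPowerSeries.X_pow_eq,
      MvPowerSeries.monomial_mul_monomial, one_mul]

open Classical in
theorem coeff_prod_commVar_pow (e : ℕ → ℕ) {M : ℕ} {α : ℕ+ →₀ ℕ}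
    (hα : ∀ a ∈ α.support, (a : ℕ) ≤ M) :
    MvPowerSeries.coeff α (∏ k ∈ range M, commVar k ^ e k) =
      if ∀ k < M, α k.succPNat = e k then 1 else 0 := by
  rw [prod_commVar_pow, MvPowerSeries.coeff_monomial]
  refine if_congr ?_ rfl rfl
  have happ : ∀ a : ℕ+, (∑ k ∈ range M, Finsupp.single k.succPNat (e k)) a =
      if a.natPred < M then e a.natPred else 0 := fun a => by
    have h : ∀ k : ℕ, k.succPNat = a ↔ k = a.natPred := fun k =>
      ⟨fun h => by rw [← h, Nat.natPred_succPNat], fun h => by rw [h, PNat.succPNat_natPred]⟩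
    rw [Finsupp.finsetSum_apply]
    simp only [Finsupp.single_apply, h, sum_ite_eq', mem_range]
  constructor
  · intro h k hk
    rw [h, happ, Nat.natPred_succPNat, if_pos hk]
  · intro h
    ext a
    rw [happ]
    split_ifs with ha
    · rw [← h _ ha, PNat.succPNat_natPred]
    · by_contra hne
      have := hα a (Finsupp.mem_support_iff.2 hne)
      have := PNat.natPred_add_one a
      omega

namespace SkewSSYT

variable {D : SkewDiagram}

open Classical in
/-- The tableaux of content `α` correspond to the chains whose sizes grow as `α` prescribes. -/
noncomputable def contentEquiv {M : ℕ} {α : ℕ+ →₀ ℕ} (hα : ∀ a ∈ α.support, (a : ℕ) ≤ M) :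
    {T : SkewSSYT D // T.content = α} ≃
      {N // N ∈ (chains D.innerPart M D.outerPart).filter fun N =>
        ∀ k < M, α k.succPNat = ∑ i, N (k + 1) i - ∑ i, N k i} := by
  refine Equiv.ofBijective (fun T => ⟨T.1.shapeUpTo, mem_filter.2 ⟨?_, ?_⟩⟩) ⟨?_, ?_⟩
  · refine T.1.shapeUpTo_mem_chains fun b => hα _ ?_
    simpa only [T.2] using T.1.entry_mem_support_content b
  · intro k _
    rw [← content_eq_sub, T.2]
  · intro T T' h
    exact Subtype.ext (shapeUpTo_injective (congrArg Subtype.val h))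
  · rintro ⟨N, hN⟩
    obtain ⟨hchain, hsize⟩ := mem_filter.1 hN
    obtain ⟨T, rfl, hM⟩ := exists_shapeUpTo_eq hchain
    refine ⟨⟨T, ?_⟩, rfl⟩
    ext a
    by_cases ha : (a : ℕ) ≤ M
    · have h1 := PNat.natPred_add_one a
      have h2 := hsize a.natPred (by omega)
      rw [← content_eq_sub, PNat.succPNat_natPred] at h2
      exact h2.symm
    · have h1 : α a = 0 := by
        by_contra h
        exact ha (hα a (Finsupp.mem_support_iff.2 h))
      rw [h1, content_apply, card_eq_zero, filter_eq_empty_iff]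
      rintro b - rfl
      exact ha (hM b)

/-- The Jacobi-Trudi formula: the coefficients of the determinant count tableaux. -/
theorem coeff_det_jacobiTrudi {M : ℕ} {α : ℕ+ →₀ ℕ} (hα : ∀ a ∈ α.support, (a : ℕ) ≤ M) :
    MvPowerSeries.coeff α (jacobiTrudi commVar M D.outerPart D.innerPart).det =
      Nat.card {T : SkewSSYT D // T.content = α} := by
  classical
  rw [det_jacobiTrudi _ _ D.antitone_outerPart D.antitone_innerPart, map_sum,
    Nat.card_congr (contentEquiv hα), Nat.card_eq_fintype_card, Fintype.card_coe,
    card_filter, Nat.cast_sum]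
  refine sum_congr rfl fun N _ => ?_
  rw [coeff_prod_commVar_pow _ hα]
  split_ifs <;> simp

/-- Each tableau of the right content contributes to a coefficient of the Rosas-Sagan function
as many permutations as fix the word. -/
theorem rosasSagan_ofFn (i : Fin D.size → ℕ+) :
    rosasSagan D (List.ofFn i) =
      stabCard i * Nat.card {T : SkewSSYT D // T.content = wordContent (List.ofFn i)} := by
  classical
  obtain ⟨M, hM⟩ : ∃ M : ℕ, ∀ a ∈ (wordContent (List.ofFn i)).support, (a : ℕ) ≤ M :=
    ⟨_, fun a ha => le_sup (f := fun a : ℕ+ => (a : ℕ)) ha⟩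
  have : Fintype {T : SkewSSYT D // T.content = wordContent (List.ofFn i)} :=
    Fintype.ofEquiv _ (contentEquiv hM).symm
  let e : {p : Perm (Fin D.size) × SkewSSYT D // p.2.word p.1 = List.ofFn i} ≃
      Σ T : {T : SkewSSYT D // T.content = wordContent (List.ofFn i)},
        {g : Perm (Fin D.size) // (T.1.entry ∘ D.readingOrder) ∘ g = i} :=
    { toFun := fun p => ⟨⟨p.1.2,
          (wordContent_ofFn_comp _ p.1.1).symm.trans (congrArg wordContent p.2)⟩, p.1.1, List.ofFn_injective p.2⟩
      invFun := fun x => ⟨(x.2.1, x.1.1), congrArg List.ofFn x.2.2⟩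
      left_inv := fun _ => rfl
      right_inv := fun _ => rfl }
  have hfib : ∀ T : {T : SkewSSYT D // T.content = wordContent (List.ofFn i)},
      Nat.card {g : Perm (Fin D.size) // (T.1.entry ∘ D.readingOrder) ∘ g = i} = stabCard i :=
    fun T => by
      rw [← stabCard_eq_of_wordContent_eq T.2, ← card_comp_eq_left T.2, Nat.card_eq_fintype_card,
        Fintype.card_subtype]
  rw [rosasSagan, Nat.card_congr e, Nat.card_sigma, sum_congr rfl fun T _ => hfib T, sum_const,
    card_univ, Nat.card_eq_fintype_card, smul_eq_mul, Nat.cast_mul, mul_comm]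

end SkewSSYT

/-! ### The symmetrization of the source skew Schur function -/

theorem sourceSchur_isHomogeneous (D : SkewDiagram) : (sourceSchur D).IsHomogeneous D.size := by
  intro w hw
  rw [sourceSchur, ncDet, NCPowerSeries.sum_apply]
  refine sum_eq_zero fun ε _ => ?_
  have h := NCPowerSeries.isHomogeneous_prod_ofFn
    (fun i : Fin D.numRows => scaledComplete ((D.outer.rowLen i : ℤ) -
      (D.inner.rowLen (ε i) : ℤ) - (i : ℤ) + (ε i : ℤ))) _
    fun i => scaledComplete_isHomogeneous _
  have hdeg : ∑ i : Fin D.numRows, ((D.outer.rowLen i : ℤ) - (D.inner.rowLen (ε i) : ℤ) - (i : ℤ) +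
      (ε i : ℤ)) = D.size := by
    rw [sum_add_distrib, sum_sub_distrib, sum_sub_distrib,
      Equiv.sum_comp ε fun i => (D.inner.rowLen i : ℤ), Equiv.sum_comp ε fun i => ((i : ℕ) : ℤ)]
    have := congrArg (Nat.cast (R := ℤ)) D.sum_outerPart
    simp only [outerPart, innerPart] at this
    push_cast at this
    linarith
  rw [hdeg] at h
  have hz := h w hw
  rcases Int.units_eq_one_or (Perm.sign ε) with hs | hs
  · rw [hs, Units.val_one, one_smul]
    exact hz
  · rw [hs, Units.val_neg, Units.val_one, neg_smul, one_smul]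
    exact neg_eq_zero.2 hz

theorem commImage_sourceSchur (D : SkewDiagram) (M : ℕ) :
    commImage M (sourceSchur D) = (jacobiTrudi commVar M D.outerPart D.innerPart).det := by
  rw [sourceSchur, map_ncDet]
  simp only [Matrix.of_apply, commImage_scaledComplete]
  rfl

/-- Symmetrizing the source skew Schur function yields the Rosas-Sagan function: at a word, both
sides are the number of the permutations that fix the word times the number of the semistandard
tableaux with the content of the word. -/
theorem sum_ncSchur (D : SkewDiagram) :
    ∑ δ : Perm (Fin D.size), ncSchur D δ = rosasSagan D := by
  classical
  ext w
  rw [NCPowerSeries.sum_apply]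
  by_cases hw : w.length = D.size
  · obtain ⟨i, rfl⟩ := exists_ofFn_eq hw
    obtain ⟨M, hM⟩ : ∃ M : ℕ, ∀ a ∈ (wordContent (List.ofFn i)).support, (a : ℕ) ≤ M :=
      ⟨_, fun a ha => le_sup (f := fun a : ℕ+ => (a : ℕ)) ha⟩
    have h := coeff_commImage M (sourceSchur D) (wordContent (List.ofFn i))
    rw [if_pos hM, commImage_sourceSchur, SkewSSYT.coeff_det_jacobiTrudi hM] at h
    rw [SkewSSYT.rosasSagan_ofFn, h]
    refine Eq.trans ?_ (sum_perm_ofFn_comp (sourceSchur D) i)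
    exact sum_congr rfl fun δ _ => permAct_ofFn δ _ i
  · have h : IsEmpty {p : Perm (Fin D.size) × SkewSSYT D // p.2.word p.1 = w} :=
      ⟨fun p => hw (by rw [← p.2, SkewSSYT.word, List.length_ofFn])⟩
    rw [rosasSagan, Nat.card_of_isEmpty, Nat.cast_zero]
    refine sum_eq_zero fun δ _ => ?_
    rw [ncSchur, permAct_of_length_ne _ _ _ hw]
    exact sourceSchur_isHomogeneous D w (by exact_mod_cast hw)

/-! ### Sums over tableaux and tabloids -/

theorem sum_ncSchur_eq_sum_schur (D : SkewDiagram) :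
    ∑ δ : Perm (Fin D.size), ncSchur D δ = ∑ t : YoungTableau D, t.schur :=
  (Fintype.sum_equiv (D.readingOrder.equivCongr (Equiv.refl (Fin D.size))) _ _ fun δ => by
    rw [ncSchur, YoungTableau.schur]
    congr 2
    ext k
    simp [YoungTableau.perm])

theorem sum_schur_eq_sum_tabloid (D : SkewDiagram) :
    ∑ t : YoungTableau D, t.schur = ∑ c : Tabloid D, c.schur := by
  classical
  rw [← sum_fiberwise univ fun t : YoungTableau D => (Quotient.mk _ t : Tabloid D)]
  refine sum_congr rfl fun c _ => ?_
  induction c using Quotient.inductionOn with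
  | h t =>
    change _ = YoungTableau.rowSchur t
    rw [YoungTableau.rowSchur]
    refine sum_congr ?_ fun _ _ => rfl
    ext t'
    simp only [mem_filter, mem_univ, true_and]
    rw [Quotient.eq]
    exact ⟨(YoungTableau.rowEquivalence D).symm, (YoungTableau.rowEquivalence D).symm⟩

theorem theorem5p7 :
    (∀ D : SkewDiagram, ∑ δ : Equiv.Perm (Fin D.size), ncSchur D δ = rosasSagan D) ∧
    (∀ lam : YoungDiagram,
      ∑ δ : Equiv.Perm (Fin (SkewDiagram.straight lam).size),
          ncSchur (SkewDiagram.straight lam) δ =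
        ∑ t : YoungTableau (SkewDiagram.straight lam), t.schur ∧
      ∑ t : YoungTableau (SkewDiagram.straight lam), t.schur =
        ∑ c : Tabloid (SkewDiagram.straight lam), c.schur ∧
      ∑ c : Tabloid (SkewDiagram.straight lam), c.schur =
        rosasSagan (SkewDiagram.straight lam)) := by
  refine ⟨sum_ncSchur, fun lam => ⟨sum_ncSchur_eq_sum_schur _, sum_schur_eq_sum_tabloid _, ?_⟩⟩
  rw [← sum_schur_eq_sum_tabloid, ← sum_ncSchur_eq_sum_schur, sum_ncSchur]
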